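/- Let $k$ be an algebraically closed field of characteristic $p>3$, let $A=k[X]/(X^p)$, let $x$ be the class of $X$, and let $W=\mathrm{Der}_k(A)$ be the Witt algebra, with basis $e_i=x^{i+1}\partial$ ($-1\le i\le p-2$), where $\partial$ is the derivation of $A$ with $\partial(x)=1$. Let $G$ be the group of automorphisms of the Lie algebra $W$. Put $W_{\ge i}=\bigoplus_{j\ge i}ke_j$, and say that $w\in W$ has degree $i$ if $w\in W_{\ge i}\setminus W_{\ge i+1}$. Every nonzero $w\in W$ has exactly one degree, it lies in $\{-1,\dots,p-2\}$, and $G$ preserves it. A complete set of representatives for the $G$-orbits of degree $i$ is: 1. $\{e_{-1}+ae_{p-2}\mid a\in k\}$ if $i=-1$; 2. $\{ae_0\mid a\in k,\ a\ne 0\}$ if $i=0$; 3. $\{e_i+ae_{2i}\mid a\in k\}$ if $1\le i<\frac{p-1}{2}$; 4. $\{e_i\}$ if $\frac{p-1}{2}\le i\le p-2$. In cases 1–3 different values of $a$ give different orbits; in case 4 there is only one orbit of degree $i$. The dimensions of the orbits (as subsets of the affine space $W$ with its Zariski topology) are: 1. $\dim G(e_{-1}+ae_{p-2})=p-1$ for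 all $a\in k$; 2. $\dim G(ae_0)=p-2$ for all $a\in k$ with $a\neq 0$; 3. $\dim G(e_i+ae_{2i})=p-i-2$ for all $a\in k$, if $1\le i<\frac{p-1}{2}$; 4. $\dim Ge_i=p-i-1$ if $\frac{p-1}{2}\le i\le p-2$. -/

import Mathlib

open Polynomial

noncomputable section

namespace WittAlgebra

/-- The truncated polynomial ring `A(1) = k[X]/(X^p)`. -/
abbrev A (k : Type*) [Field k] (p : ℕ) : Type _ :=
  k[X] ⧸ Ideal.span {(X : k[X]) ^ p}

/-- The class `x` of `X` in `A(1)`. -/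
def x (k : Type*) [Field k] (p : ℕ) : A k p :=
  Ideal.Quotient.mk (Ideal.span {(X : k[X]) ^ p}) X

/-- The Witt algebra: the Lie algebra of `k`-derivations of `A(1)`, with the commutator bracket. -/
abbrev W (k : Type*) [Field k] (p : ℕ) : Type _ :=
  Derivation k (A k p) (A k p)

/-- In characteristic `p` the derivative preserves the ideal `(X^p)`. -/
theorem derivative_mem (k : Type*) [Field k] (p : ℕ) [CharP k p] (f : k[X])
    (hf : f ∈ Ideal.span {(X : k[X]) ^ p}) :
    derivative f ∈ Ideal.span {(X : k[X]) ^ p} := by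
  rw [Ideal.mem_span_singleton] at hf ⊢
  obtain ⟨g, rfl⟩ := hf
  simp [derivative_mul, derivative_X_pow]

/-- The derivation `∂` of `A(1)`: the map induced on `k[X]/(X^p)` by `d/dX`. -/
def partialD (k : Type*) [Field k] (p : ℕ) [CharP k p] : W k p :=
  Derivation.liftOfSurjective (f := Ideal.Quotient.mkₐ k (Ideal.span {(X : k[X]) ^ p}))
    (d := Polynomial.derivative')
    (Ideal.Quotient.mkₐ_surjective k _)
    (fun f hf => Ideal.Quotient.eq_zero_iff_mem.2
      (derivative_mem k p f (Ideal.Quotient.eq_zero_iff_mem.1 hf)))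

/-- `e_i = x^(i+1) ∂`, meaningful for `-1 ≤ i ≤ p - 2`; it is `0` outside this range
(for `i ≥ p - 1` because `x^p = 0`). -/
def e (k : Type*) [Field k] (p : ℕ) [CharP k p] (i : ℤ) : W k p :=
  if -1 ≤ i then x k p ^ (i + 1).toNat • partialD k p else 0

/-- `W_{≥ i}`, the span of the `e_j` with `j ≥ i`. -/
def filtration (k : Type*) [Field k] (p : ℕ) [CharP k p] (i : ℤ) : Submodule k (W k p) :=
  Submodule.span k (e k p '' {j | i ≤ j ∧ -1 ≤ j ∧ j ≤ (p : ℤ) - 2})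

/-- `w` has degree `i` if `w ∈ W_{≥ i} \ W_{≥ i+1}`. -/
def HasDegree {k : Type*} [Field k] {p : ℕ} [CharP k p] (w : W k p) (i : ℤ) : Prop :=
  w ∈ filtration k p i ∧ w ∉ filtration k p (i + 1)

/-- The orbit of `w` under the group `G` of all automorphisms of the Lie algebra `W`. -/
def orbit {k : Type*} [Field k] {p : ℕ} (w : W k p) : Set (W k p) :=
  Set.range fun σ : W k p ≃ₗ⁅k⁆ W k p => σ w

/-- `R` is a complete set of representatives for the orbits of degree `i`: it consists of elements
of degree `i`, and every element of degree `i` is in the orbit of exactly one element of `R`. -/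
def IsSetOfRepresentatives {k : Type*} [Field k] {p : ℕ} [CharP k p]
    (R : Set (W k p)) (i : ℤ) : Prop :=
  (∀ r ∈ R, HasDegree r i) ∧ ∀ w : W k p, HasDegree w i → ∃! r, r ∈ R ∧ w ∈ orbit r

/-- The algebra of polynomial functions on a vector space `V`, generated by the linear forms. -/
def polyFun (k V : Type*) [Field k] [AddCommGroup V] [Module k V] : Subalgebra k (V → k) :=
  Algebra.adjoin k (Set.range fun f : Module.Dual k V => (f : V → k))

/-- The common zeros of a set of functions. -/
def zeros {k V : Type*} [Field k] (S : Set (V → k)) : Set V :=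
  {v | ∀ f ∈ S, f v = 0}

/-- The Zariski topology on a (finite-dimensional) vector space: the closed sets are the common
zero sets of sets of polynomial functions. -/
abbrev zariskiTopology (k V : Type*) [Field k] [AddCommGroup V] [Module k V] : TopologicalSpace V :=
  TopologicalSpace.ofClosed {Z | ∃ S : Set (V → k), S ⊆ polyFun k V ∧ Z = zeros S}
    ⟨{1}, by simp, by ext v; simp [zeros]⟩
    (by
      intro B hB
      refine ⟨{f | f ∈ polyFun k V ∧ ∃ Z ∈ B, ∀ v ∈ Z, f v = 0}, fun f hf => hf.1, ?_⟩
      ext v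
      simp only [Set.mem_sInter, zeros, Set.mem_ofPred_eq]
      constructor
      · rintro hv f ⟨-, Z, hZ, hf⟩
        exact hf v (hv Z hZ)
      · intro hv Z hZ
        obtain ⟨S, hS, rfl⟩ := hB hZ
        exact fun f hf => hv f ⟨hS hf, _, hZ, fun u hu => hu f hf⟩)
    (by
      rintro _ ⟨S, hS, rfl⟩ _ ⟨T, hT, rfl⟩
      refine ⟨{h | ∃ f ∈ S, ∃ g ∈ T, h = f * g}, ?_, ?_⟩
      · rintro _ ⟨f, hf, g, hg, rfl⟩
        exact mul_mem (hS hf) (hT hg)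
      · ext v
        simp only [Set.mem_union, zeros, Set.mem_ofPred_eq]
        constructor
        · rintro (hv | hv) _ ⟨f, hf, g, hg, rfl⟩
          · simp [hv f hf]
          · simp [hv g hg]
        · intro hv
          by_contra hc
          push Not at hc
          obtain ⟨⟨f, hf, hfv⟩, g, hg, hgv⟩ := hc
          exact mul_ne_zero hfv hgv (hv _ ⟨f, hf, g, hg, rfl⟩))

/-- The dimension of a subset of a vector space: its Krull dimension as a topological space, for
the subspace topology of the Zariski topology. -/
def zariskiDim (k : Type*) {V : Type*} [Field k] [AddCommGroup V] [Module k V] (S : Set V) :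
    WithBot ℕ∞ :=
  letI : TopologicalSpace V := zariskiTopology k V
  topologicalKrullDim S

end WittAlgebra

end

/-! Write a derivation as `f ∂` with `f` in `A`. For `p > 3` every automorphism of `W` comes from a
substitution `φ : x ↦ y = x u` with `u` a unit (`exists_eq_adConj`). Indeed the elements with `(ad
w)² = 0` form an invariant set whose normalizer is `W_{≥ 0}`, so `W_{≥ 0}` is preserved. After
composing with a substitution the automorphism fixes `∂`, and then it is the identity. Hence `f ∂`
and `g ∂` are conjugate iff `φ(f) = g y'` for some `φ` (`mem_orbit_iff`), that is, iff `φ` carries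
the differential `dx/f` to `dx/g`.

Let `f` have order `n = i + 1` and leading coefficient `c`. The substitution `x ↦ x + t x^(j+1)`
first changes `f` at `x^(n+j)`, by `(n - 1 - j) t c`, so every later term except that of exponent
`2n - 1` can be removed. For `n ≥ 2` scaling `x` makes `c = 1`; for `n = 1` the coefficient `c` is
itself invariant. The surviving parameter is a residue: if `2 ≤ n` and `2n ≤ p`, the residue of
`dx/f` is invariant (`coeffA_inv_of_x_pow`). If `n = 0`, the coefficient of `x^(p-1)` in `1/f` is
multiplied by `u(0)^p` and the constant term by `u(0)` (`coeffA_inv_of_unit`). If `2n > p`, then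
`x^(2n-1) = 0` and no parameter is left.

Each orbit is thus cut out by explicit conditions on coefficients. A residue condition is linear in
one coefficient, which it expresses through the others, so the orbit projects homeomorphically onto
a nonempty principal open subset of an affine space (`zariskiDim_eq_of_regular`), whose dimension is
the number of free coefficients. -/

noncomputable section

namespace WittAlgebra

/-! ### Coefficients, units and `p`-th powers in the truncated polynomial ring. -/

section

variable {k : Type*} [Field k] {p : ℕ}

/-- The `n`-th coefficient of an element of `A`, seen as a polynomial of degree less than `p`. -/
def coeffA (n : ℕ) : A k p →ₗ[k] k where
  toFun a := (AdjoinRoot.modByMonicHom (monic_X_pow (R := k) p) a).coeff n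
  map_add' a b := by
    rw [← coeff_add]
    exact congrArg (fun q : k[X] => q.coeff n)
      (map_add (AdjoinRoot.modByMonicHom (monic_X_pow (R := k) p)) a b)
  map_smul' c a := by
    rw [RingHom.id_apply, ← coeff_smul]
    exact congrArg (fun q : k[X] => q.coeff n)
      (map_smul (AdjoinRoot.modByMonicHom (monic_X_pow (R := k) p)) c a)

/-- The class of a polynomial in `A`. -/
abbrev mkA (k : Type*) [Field k] (p : ℕ) : k[X] →ₐ[k] A k p :=
  Ideal.Quotient.mkₐ k (Ideal.span {(X : k[X]) ^ p})

theorem mkA_surjective : Function.Surjective (mkA k p) := Ideal.Quotient.mkₐ_surjective k _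

theorem mkA_X : mkA k p X = x k p := rfl

theorem mkA_eq_aeval (F : k[X]) : mkA k p F = aeval (x k p) F := by
  rw [← mkA_X, aeval_algHom_apply, aeval_X_left_apply]

theorem mkA_eq_zero_iff (F : k[X]) : mkA k p F = 0 ↔ X ^ p ∣ F := by
  rw [← Ideal.mem_span_singleton]
  exact Ideal.Quotient.eq_zero_iff_mem

theorem smul_eq_algebraMap_mul (c : k) (a : A k p) : c • a = algebraMap k (A k p) c * a :=
  Algebra.smul_def c a

theorem x_pow_p : x k p ^ p = 0 := by
  rw [← mkA_X, ← map_pow, mkA_eq_zero_iff]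

theorem coeffA_mkA {n : ℕ} (hn : n < p) (F : k[X]) : coeffA n (mkA k p F) = F.coeff n := by
  have h1 : coeffA n (mkA k p F) = (F %ₘ X ^ p).coeff n :=
    congrArg (fun q : k[X] => q.coeff n)
      (AdjoinRoot.modByMonicHom_mk (monic_X_pow (R := k) p) F)
  have h2 := congrArg (fun q : k[X] => q.coeff n) (modByMonic_add_div F (X ^ p : k[X]))
  rw [h1, ← h2]
  simp [coeff_X_pow_mul', hn]

theorem coeffA_x_pow_mul {n : ℕ} (hn : n < p) (m : ℕ) (a : A k p) :
    coeffA n (x k p ^ m * a) = if m ≤ n then coeffA (n - m) a else 0 := by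
  obtain ⟨F, rfl⟩ := mkA_surjective a
  rw [← mkA_X, ← map_pow, ← map_mul, coeffA_mkA hn, coeff_X_pow_mul']
  split_ifs
  · rw [coeffA_mkA (by omega)]
  · rfl

theorem coeffA_mul {n : ℕ} (hn : n < p) (a b : A k p) :
    coeffA n (a * b) = ∑ ij ∈ Finset.HasAntidiagonal.antidiagonal n, coeffA ij.1 a * coeffA ij.2 b := by
  obtain ⟨F, rfl⟩ := mkA_surjective a
  obtain ⟨G, rfl⟩ := mkA_surjective b
  rw [← map_mul, coeffA_mkA hn, coeff_mul]
  refine Finset.sum_congr rfl fun ij hij => ?_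
  have := Finset.HasAntidiagonal.mem_antidiagonal.1 hij
  rw [coeffA_mkA (by omega), coeffA_mkA (by omega)]

theorem coeffA_x_pow {n : ℕ} (hn : n < p) (m : ℕ) :
    coeffA n (x k p ^ m) = if n = m then 1 else 0 := by
  rw [← mkA_X, ← map_pow, coeffA_mkA hn, coeff_X_pow]

theorem coeffA_one {n : ℕ} (hn : n < p) : coeffA n (1 : A k p) = if n = 0 then 1 else 0 := by
  simpa using coeffA_x_pow (k := k) hn 0

theorem x_pow_dvd_iff {m : ℕ} (hm : m ≤ p) (a : A k p) :
    x k p ^ m ∣ a ↔ ∀ n < m, coeffA n a = 0 := by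
  constructor
  · rintro ⟨b, rfl⟩ n hn
    rw [coeffA_x_pow_mul (by omega), if_neg (by omega)]
  · intro h
    obtain ⟨F, rfl⟩ := mkA_surjective a
    rw [← mkA_X, ← map_pow]
    refine map_dvd _ (X_pow_dvd_iff.2 fun n hn => ?_)
    rw [← h n hn, coeffA_mkA (by omega)]

theorem eq_zero_of_coeffA {a : A k p} (h : ∀ n < p, coeffA n a = 0) : a = 0 := by
  have := (x_pow_dvd_iff le_rfl a).2 h
  rwa [x_pow_p, zero_dvd_iff] at this

theorem ext_coeffA {a b : A k p} (h : ∀ n < p, coeffA n a = coeffA n b) : a = b :=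
  sub_eq_zero.1 (eq_zero_of_coeffA fun n hn => by rw [map_sub, h n hn, sub_self])

/-- The element of `A` with given coefficients. -/
theorem exists_coeffA_eq (c : ℕ → k) : ∃ a : A k p, ∀ n < p, coeffA n a = c n := by
  refine ⟨mkA k p (∑ i ∈ Finset.range p, monomial i (c i)), fun n hn => ?_⟩
  rw [coeffA_mkA hn]
  simp [coeff_monomial, hn]

theorem x_pow_dvd_iff_coeffA_sub {m : ℕ} (hm : m ≤ p) (a b : A k p) :
    x k p ^ m ∣ a - b ↔ ∀ n < m, coeffA n a = coeffA n b := by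
  simp only [x_pow_dvd_iff hm, map_sub, sub_eq_zero]

section Prime

variable [Fact p.Prime]

theorem prime_pos' : 0 < p := (Fact.out : p.Prime).pos

theorem coeffA_zero_mul (a b : A k p) : coeffA 0 (a * b) = coeffA 0 a * coeffA 0 b := by
  simp [coeffA_mul (prime_pos' (p := p))]

theorem coeffA_zero_one : coeffA 0 (1 : A k p) = 1 := by
  simp [coeffA_one (prime_pos' (p := p))]

theorem coeffA_zero_pow (a : A k p) (n : ℕ) : coeffA 0 (a ^ n) = coeffA 0 a ^ n := by
  induction n with
  | zero => simp [coeffA_zero_one]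
  | succ n ih => rw [pow_succ, pow_succ, coeffA_zero_mul, ih]

theorem eq_algebraMap_add (a : A k p) :
    ∃ b, a = algebraMap k (A k p) (coeffA 0 a) + x k p * b := by
  have h : x k p ^ 1 ∣ a - algebraMap k (A k p) (coeffA 0 a) := by
    rw [x_pow_dvd_iff_coeffA_sub (Fact.out : p.Prime).one_lt.le]
    intro n hn
    obtain rfl : n = 0 := by omega
    rw [Algebra.algebraMap_eq_smul_one, map_smul, coeffA_zero_one, smul_eq_mul, mul_one]
  obtain ⟨b, hb⟩ := h
  exact ⟨b, by rw [← sub_eq_iff_eq_add', hb, pow_one]⟩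

omit [Fact p.Prime] in
theorem isNilpotent_x_mul (b : A k p) : IsNilpotent (x k p * b) :=
  ⟨p, by rw [mul_pow, x_pow_p, zero_mul]⟩

theorem isUnit_iff_coeffA (a : A k p) : IsUnit a ↔ coeffA 0 a ≠ 0 := by
  constructor
  · rintro h h0
    obtain ⟨b, hb⟩ := h.exists_right_inv
    have := coeffA_zero_mul a b
    rw [hb, coeffA_zero_one, h0, zero_mul] at this
    exact one_ne_zero this
  · intro h
    obtain ⟨b, hb⟩ := eq_algebraMap_add a
    rw [hb]
    exact (isNilpotent_x_mul b).isUnit_add_left_of_commute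
      ((IsUnit.mk0 _ h).map (algebraMap k (A k p))) (Commute.all _ _)

/-- Frobenius is additive and kills the nilpotent part `x * b`. This makes `u ^ p` a constant, so
negative powers of `u` can be replaced by positive ones. -/
theorem pow_p [CharP k p] (a : A k p) : a ^ p = algebraMap k (A k p) (coeffA 0 a ^ p) := by
  obtain ⟨b, hb⟩ := eq_algebraMap_add a
  have : Nontrivial (A k p) := ⟨1, 0, fun h => by
    have := coeffA_zero_one (k := k) (p := p)
    simp [h] at this⟩
  have : CharP (A k p) p := charP_of_injective_algebraMap (algebraMap k (A k p)).injective p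
  conv_lhs => rw [hb]
  rw [add_pow_char, mul_pow, x_pow_p, zero_mul, add_zero, map_pow]

/-- Every nonzero element of `A` is a power of `x` times a unit. -/
theorem exists_eq_x_pow_mul {m : ℕ} (hm : m < p) {a : A k p} (h : ∀ n < m, coeffA n a = 0)
    (h' : coeffA m a ≠ 0) : ∃ b, a = x k p ^ m * b ∧ coeffA 0 b = coeffA m a ∧ IsUnit b := by
  obtain ⟨b, rfl⟩ := (x_pow_dvd_iff hm.le a).2 h
  have : coeffA m (x k p ^ m * b) = coeffA 0 b := by
    rw [coeffA_x_pow_mul hm, if_pos le_rfl, Nat.sub_self]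
  exact ⟨b, rfl, this.symm, (isUnit_iff_coeffA b).2 (this ▸ h')⟩

end Prime

/-! ### Derivations as multiples of `∂`, and the filtration as divisibility by powers of `x`. -/

section Derivation

variable [CharP k p]

theorem partialD_mkA (F : k[X]) : partialD k p (mkA k p F) = mkA k p (derivative F) :=
  Derivation.liftOfSurjective_apply (Ideal.Quotient.mkₐ_surjective k _)
    (fun f hf => Ideal.Quotient.eq_zero_iff_mem.2
      (derivative_mem k p f (Ideal.Quotient.eq_zero_iff_mem.1 hf))) F

theorem partialD_smul (c : k) (a : A k p) : partialD k p (c • a) = c • partialD k p a :=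
  Derivation.map_smul _ c a

theorem partialD_x : partialD k p (x k p) = 1 := by
  rw [← mkA_X, partialD_mkA]
  simp

theorem coeffA_partialD {n : ℕ} (hn : n < p) (a : A k p) :
    coeffA n (partialD k p a) = (n + 1) * coeffA (n + 1) a := by
  obtain ⟨F, rfl⟩ := mkA_surjective a
  rw [partialD_mkA, coeffA_mkA hn, coeff_derivative, mul_comm]
  rcases (Nat.succ_le_of_lt hn).lt_or_eq with h | h
  · rw [coeffA_mkA h]
  · have : ((n : k) + 1) = 0 := by
      have := CharP.cast_eq_zero k p
      rw [← h] at this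
      exact_mod_cast this
    simp [this]

theorem cast_ne_zero_of_lt {n : ℕ} (h0 : n ≠ 0) (hn : n < p) : (n : k) ≠ 0 := by
  rw [Ne, CharP.cast_eq_zero_iff k p]
  exact fun h => absurd (Nat.le_of_dvd (Nat.pos_of_ne_zero h0) h) (by omega)

/-- An element of `A` without term of degree `p - 1` is a derivative. -/
theorem exists_partialD_eq [Fact p.Prime] {a : A k p} (h : coeffA (p - 1) a = 0) :
    ∃ b, partialD k p b = a ∧ coeffA 0 b = 0 := by
  have hp := prime_pos' (p := p)
  obtain ⟨b, hb⟩ := exists_coeffA_eq (p := p)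
    fun n => if n = 0 then 0 else (n : k)⁻¹ * coeffA (n - 1) a
  refine ⟨b, ext_coeffA fun n hn => ?_, by simp [hb 0 hp]⟩
  rw [coeffA_partialD hn]
  rcases (Nat.succ_le_of_lt hn).lt_or_eq with h1 | h1
  · have := cast_ne_zero_of_lt (k := k) (Nat.succ_ne_zero n) h1
    rw [hb _ h1, if_neg (Nat.succ_ne_zero n)]
    simp only [Nat.succ_eq_add_one, Nat.add_sub_cancel]
    push_cast at this ⊢
    rw [mul_inv_cancel_left₀ this]
  · have h2 : ((n : k) + 1) = 0 := by
      have := CharP.cast_eq_zero k p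
      rw [← h1] at this
      exact_mod_cast this
    rw [h2, zero_mul, ← h, show p - 1 = n by omega]

theorem derivation_eq_smul (D : W k p) : D = D (x k p) • partialD k p := by
  refine Derivation.ext fun a => ?_
  obtain ⟨F, rfl⟩ := mkA_surjective a
  rw [mkA_eq_aeval, Derivation.map_aeval, Derivation.smul_apply, Derivation.map_aeval,
    partialD_x]
  simp [mul_comm]

theorem derivation_apply (D : W k p) (a : A k p) : D a = D (x k p) * partialD k p a :=
  congrArg (fun E : W k p => E a) (derivation_eq_smul D)

theorem derivation_ext_x {D E : W k p} (h : D (x k p) = E (x k p)) : D = E := by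
  rw [derivation_eq_smul D, derivation_eq_smul E, h]

theorem smul_partialD_x (f : A k p) : (f • partialD k p) (x k p) = f := by
  rw [Derivation.smul_apply, partialD_x, smul_eq_mul, mul_one]

theorem bracket_x (D E : W k p) :
    ⁅D, E⁆ (x k p) = D (x k p) * partialD k p (E (x k p)) -
      E (x k p) * partialD k p (D (x k p)) := by
  rw [Derivation.commutator_apply]
  conv_lhs => rw [derivation_eq_smul D, derivation_eq_smul E]
  simp [partialD_x]

/-- A derivation of `A` is determined by its value at `x`, which is arbitrary. -/
def valueAtX : W k p ≃ₗ[k] A k p where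
  toFun D := D (x k p)
  invFun f := f • partialD k p
  map_add' _ _ := rfl
  map_smul' _ _ := rfl
  left_inv D := (derivation_eq_smul D).symm
  right_inv f := smul_partialD_x f

theorem partialD_x_pow (m : ℕ) :
    partialD k p (x k p ^ m) = (m : k) • x k p ^ (m - 1) := by
  rw [Derivation.leibniz_pow, partialD_x, smul_eq_mul, mul_one, Nat.cast_smul_eq_nsmul]

theorem e_apply_x (n : ℕ) : e k p ((n : ℤ) - 1) (x k p) = x k p ^ n := by
  rw [e, if_pos (by omega), smul_partialD_x]
  congr 1
  omega

/-- The bridge from the indexing by `i` to orders of vanishing; the shift `i = n - 1` comes from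
`e_i = x^(i+1) ∂` and is kept throughout. -/
theorem mem_filtration_iff [Fact p.Prime] {n : ℕ} (hn : n ≤ p) (w : W k p) :
    w ∈ filtration k p ((n : ℤ) - 1) ↔ x k p ^ n ∣ w (x k p) := by
  constructor
  · intro h
    induction h using Submodule.span_induction with
    | mem w hw =>
      obtain ⟨j, ⟨h1, h2, h3⟩, rfl⟩ := hw
      obtain ⟨m, rfl⟩ : ∃ m : ℕ, j = (m : ℤ) - 1 := ⟨(j + 1).toNat, by omega⟩
      rw [e_apply_x]
      exact pow_dvd_pow _ (by omega)
    | zero => exact dvd_zero _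
    | add a b _ _ ha hb => exact dvd_add ha hb
    | smul c a _ ha => exact ha.trans ⟨algebraMap k _ c,
        (Algebra.smul_def c (a (x k p))).trans (mul_comm _ _)⟩
  · rintro h
    rw [x_pow_dvd_iff hn] at h
    have : w = ∑ m ∈ Finset.range p, coeffA m (w (x k p)) • e k p ((m : ℤ) - 1) := by
      refine valueAtX.injective (ext_coeffA fun m hm => ?_)
      simp only [map_sum, map_smul]
      rw [Finset.sum_eq_single_of_mem m (Finset.mem_range.2 hm)]
      · change _ = _ • coeffA m (e k p ((m : ℤ) - 1) (x k p))
        rw [e_apply_x, coeffA_x_pow hm, if_pos rfl, smul_eq_mul, mul_one]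
        rfl
      · intro q _ hq
        change _ • coeffA m (e k p ((q : ℤ) - 1) (x k p)) = 0
        rw [e_apply_x, coeffA_x_pow hm, if_neg hq.symm, smul_zero]
    rw [this]
    refine Submodule.sum_mem _ fun m hm => ?_
    by_cases hmn : m < n
    · rw [h m hmn, zero_smul]
      exact Submodule.zero_mem _
    · have := Finset.mem_range.1 hm
      exact Submodule.smul_mem _ _ (Submodule.subset_span ⟨_, ⟨by omega, by omega, by omega⟩, rfl⟩)

end Derivation

end

/-! ### Automorphisms of `A` and their action on `W` by conjugation. -/

section

variable {k : Type*} [Field k] {p : ℕ}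

/-- Conjugation of derivations by an automorphism of `A`. -/
def adConj (φ : A k p ≃ₐ[k] A k p) : W k p ≃ₗ⁅k⁆ W k p where
  toFun D := Derivation.mk' ((φ.toLinearMap ∘ₗ D.toLinearMap) ∘ₗ φ.symm.toLinearMap)
    (fun a b => by simp)
  map_add' D E := Derivation.ext fun a => map_add φ (D (φ.symm a)) (E (φ.symm a))
  map_smul' c D := Derivation.ext fun a => map_smul φ c (D (φ.symm a))
  map_lie' {D E} := Derivation.ext fun a => by
    rw [Derivation.commutator_apply]
    change φ (⁅D, E⁆ (φ.symm a)) =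
      φ (D (φ.symm (φ (E (φ.symm a))))) - φ (E (φ.symm (φ (D (φ.symm a)))))
    rw [AlgEquiv.symm_apply_apply, AlgEquiv.symm_apply_apply, Derivation.commutator_apply, map_sub]
  invFun D := Derivation.mk' ((φ.symm.toLinearMap ∘ₗ D.toLinearMap) ∘ₗ φ.toLinearMap)
    (fun a b => by simp)
  left_inv D := Derivation.ext fun a => by
    change φ.symm (φ (D (φ.symm (φ a)))) = D a
    simp
  right_inv D := Derivation.ext fun a => by
    change φ (φ.symm (D (φ (φ.symm a)))) = D a
    simp

theorem adConj_apply (φ : A k p ≃ₐ[k] A k p) (D : W k p) (a : A k p) :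
    adConj φ D a = φ (D (φ.symm a)) := rfl

theorem lieEquiv_map_sub (σ : W k p ≃ₗ⁅k⁆ W k p) (u v : W k p) : σ (u - v) = σ u - σ v :=
  map_sub σ.toLieHom u v

theorem lieEquiv_map_neg (σ : W k p ≃ₗ⁅k⁆ W k p) (u : W k p) : σ (-u) = -σ u :=
  map_neg σ.toLieHom u

theorem lieEquiv_map_smul (σ : W k p ≃ₗ⁅k⁆ W k p) (c : k) (u : W k p) : σ (c • u) = c • σ u :=
  map_smul σ.toLieHom c u

theorem lieEquiv_map_zero (σ : W k p ≃ₗ⁅k⁆ W k p) : σ 0 = 0 :=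
  map_zero σ.toLieHom

theorem algEquiv_mkA (φ : A k p ≃ₐ[k] A k p) (F : k[X]) :
    φ (mkA k p F) = aeval (φ (x k p)) F := by
  rw [mkA_eq_aeval, aeval_algHom_apply]

theorem mem_orbit_trans {u v w : W k p} (h : u ∈ orbit v) (h' : v ∈ orbit w) : u ∈ orbit w := by
  obtain ⟨σ, rfl⟩ := h
  obtain ⟨τ, rfl⟩ := h'
  exact ⟨τ.trans σ, rfl⟩

theorem mem_orbit_symm {u v : W k p} (h : u ∈ orbit v) : v ∈ orbit u := by
  obtain ⟨σ, rfl⟩ := h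
  exact ⟨σ.symm, σ.symm_apply_apply v⟩

theorem mem_orbit_self (u : W k p) : u ∈ orbit u := ⟨LieEquiv.refl, rfl⟩

section

variable [Fact p.Prime]

/-- Any element `x * u` with `u` a unit is the image of `x` under an automorphism of `A`. -/
theorem exists_algEquiv (u : A k p) (hu : IsUnit u) :
    ∃ φ : A k p ≃ₐ[k] A k p, φ (x k p) = x k p * u := by
  have hker : ∀ F : k[X], F ∈ Ideal.span {(X : k[X]) ^ p} → aeval (x k p * u) F = 0 := by
    intro F hF
    obtain ⟨G, rfl⟩ := Ideal.mem_span_singleton.1 hF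
    rw [map_mul, map_pow, aeval_X, mul_pow, x_pow_p, zero_mul, zero_mul]
  let ψ : A k p →ₐ[k] A k p := Ideal.Quotient.liftₐ _ (aeval (x k p * u)) hker
  have hψ : ψ (x k p) = x k p * u := by
    change aeval (x k p * u) X = _
    rw [aeval_X]
  -- A nonzero element is `x^n` times a unit with `n < p`, and its image is again `x^n` times a
  -- unit. Surjectivity then follows by finite dimension.
  have hinj : Function.Injective ψ := by
    rw [injective_iff_map_eq_zero]
    intro a ha
    refine eq_zero_of_coeffA fun n => ?_
    induction n using Nat.strong_induction_on with
    | _ n ih =>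
      intro hn
      by_contra h
      obtain ⟨b, rfl, -, hb⟩ := exists_eq_x_pow_mul hn (fun m hm => ih m hm (hm.trans hn)) h
      rw [map_mul, map_pow, hψ, mul_pow, mul_assoc,
        ((hu.pow n).mul (hb.map ψ)).mul_left_eq_zero] at ha
      have := coeffA_x_pow (k := k) hn n
      simp [ha] at this
  have : Module.Finite k (A k p) := (monic_X_pow (R := k) p).finite_quotient
  have hsurj : Function.Surjective ψ := LinearMap.surjective_of_injective (f := ψ.toLinearMap) hinj
  exact ⟨AlgEquiv.ofBijective ψ ⟨hinj, hsurj⟩, hψ⟩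

/-- `φ x` is nilpotent, so it has no constant term. If its linear term vanished too, `φ (x^(p-1))`
would be divisible by `x^(2(p-1)) = 0`, against injectivity. -/
theorem algEquiv_x (φ : A k p ≃ₐ[k] A k p) : ∃ u, φ (x k p) = x k p * u ∧ IsUnit u := by
  have hp := (Fact.out : p.Prime).two_le
  have hx : coeffA 0 (φ (x k p)) = 0 := by
    have h := coeffA_zero_pow (φ (x k p)) p
    rw [← map_pow, x_pow_p, map_zero, map_zero] at h
    exact pow_eq_zero_iff (by omega) |>.1 h.symm
  obtain ⟨u, hu⟩ := (x_pow_dvd_iff (m := 1) (by omega) (φ (x k p))).2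
    (fun n hn => by obtain rfl : n = 0 := by omega
                    exact hx)
  rw [pow_one] at hu
  refine ⟨u, hu, (isUnit_iff_coeffA u).2 fun h0 => ?_⟩
  obtain ⟨v, rfl⟩ := (x_pow_dvd_iff (m := 1) (by omega) u).2
    (fun n hn => by obtain rfl : n = 0 := by omega
                    exact h0)
  have h1 : φ (x k p ^ (p - 1)) = 0 := by
    rw [map_pow, hu, pow_one, ← mul_assoc, ← pow_two, mul_pow, ← pow_mul,
      show 2 * (p - 1) = p + (p - 2) by omega, pow_add, x_pow_p, zero_mul, zero_mul]
  rw [map_eq_zero_iff φ φ.injective] at h1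
  have := coeffA_x_pow (k := k) (p := p) (n := p - 1) (by omega) (p - 1)
  simp [h1] at this

theorem x_pow_dvd_map (φ : A k p ≃ₐ[k] A k p) {n : ℕ} {a : A k p} (h : x k p ^ n ∣ a) :
    x k p ^ n ∣ φ a := by
  obtain ⟨u, hu, -⟩ := algEquiv_x φ
  obtain ⟨b, rfl⟩ := h
  rw [map_mul, map_pow, hu, mul_pow, mul_assoc]
  exact dvd_mul_right _ _

variable [CharP k p]

theorem coeffA_zero_partialD_x_mul (u : A k p) :
    coeffA 0 (partialD k p (x k p * u)) = coeffA 0 u := by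
  rw [Derivation.leibniz, partialD_x, smul_eq_mul, smul_eq_mul, mul_one, map_add,
    ← pow_one (x k p), coeffA_x_pow_mul prime_pos']
  simp

theorem isUnit_partialD_map_x (φ : A k p ≃ₐ[k] A k p) : IsUnit (partialD k p (φ (x k p))) := by
  obtain ⟨u, hu, hu'⟩ := algEquiv_x φ
  rw [isUnit_iff_coeffA, hu, coeffA_zero_partialD_x_mul]
  exact (isUnit_iff_coeffA u).1 hu'

/-- The change of variables formula for vector fields: evaluate the conjugate at `φ x`, apply the
chain rule, and cancel the unit `∂(φ x)`. -/
theorem adConj_eq_iff (φ : A k p ≃ₐ[k] A k p) (D E : W k p) :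
    adConj φ D = E ↔ φ (D (x k p)) = E (x k p) * partialD k p (φ (x k p)) := by
  have h1 : φ (D (x k p)) = adConj φ D (x k p) * partialD k p (φ (x k p)) := by
    rw [← derivation_apply, adConj_apply, AlgEquiv.symm_apply_apply]
  rw [h1]
  constructor
  · rintro rfl
    rfl
  · intro h
    exact derivation_ext_x ((isUnit_partialD_map_x φ).mul_right_cancel h)

omit [Fact p.Prime] [CharP k p] in
theorem x_pow_dvd_smul {m : ℕ} {a : A k p} (h : x k p ^ m ∣ a) (c : k) : x k p ^ m ∣ c • a :=
  h.trans ⟨algebraMap k _ c, (Algebra.smul_def c a).trans (mul_comm _ _)⟩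

omit [Fact p.Prime] in
theorem x_pow_dvd_partialD {m : ℕ} {a : A k p} (h : x k p ^ m ∣ a) :
    x k p ^ (m - 1) ∣ partialD k p a := by
  obtain ⟨b, rfl⟩ := h
  rw [Derivation.leibniz, partialD_x_pow]
  refine dvd_add ?_ ?_
  · exact ((pow_dvd_pow _ (Nat.sub_le _ _)).mul_right _)
  · rw [smul_eq_mul]
    exact Dvd.dvd.mul_left (x_pow_dvd_smul (dvd_refl _) _) _

/-! ### Sandwich elements, and the reduction of automorphisms of `W` to automorphisms of `A`. -/

/-- The elements `w` with `(ad w)² = 0` (the sandwich elements). -/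
def IsSandwich (w : W k p) : Prop := ∀ u : W k p, ⁅w, ⁅w, u⁆⁆ = 0

omit [Fact p.Prime] in
theorem bracket_bracket_x (w u : W k p) :
    ⁅w, ⁅w, u⁆⁆ (x k p) =
      w (x k p) ^ 2 * partialD k p (partialD k p (u (x k p)))
      - w (x k p) * partialD k p (partialD k p (w (x k p))) * u (x k p)
      - w (x k p) * partialD k p (w (x k p)) * partialD k p (u (x k p))
      + partialD k p (w (x k p)) ^ 2 * u (x k p) := by
  rw [bracket_x, bracket_x]
  simp only [map_sub, Derivation.leibniz, smul_eq_mul]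
  ring

omit [Fact p.Prime] [CharP k p] in
theorem mul_eq_zero_of_x_pow_dvd {m n : ℕ} (h : p ≤ m + n) {a b : A k p}
    (ha : x k p ^ m ∣ a) (hb : x k p ^ n ∣ b) : a * b = 0 := by
  have := (pow_dvd_pow (x k p) h).trans (pow_add (x k p) m n ▸ mul_dvd_mul ha hb)
  rwa [x_pow_p, zero_dvd_iff] at this

omit [Fact p.Prime] [CharP k p] in
theorem x_pow_mul_unit_eq_zero {m : ℕ} {a : A k p} (ha : IsUnit a) (h : x k p ^ m * a = 0) :
    p ≤ m := by
  by_contra hm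
  rw [ha.mul_left_eq_zero] at h
  have := coeffA_x_pow (k := k) (p := p) (n := m) (by omega) m
  simp [h] at this

/-- For `w = f ∂`, testing on `∂`, `x ∂`, `x² ∂` gives `f'² = f f''`, `f f' = 0` and `f² = 0`;
differentiating the second yields `f'² = 0`. If `f` has order `n` with `0 < n < p`, then `f'` has
order exactly `n - 1`, so `2(n - 1) ≥ p`, and oddness of `p` gives the bound `(p + 3) / 2`.
Conversely, at this order every product in `bracket_bracket_x` vanishes. -/
theorem isSandwich_iff (hp : 3 < p) (w : W k p) :
    IsSandwich w ↔ x k p ^ ((p + 3) / 2) ∣ w (x k p) := by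
  have hodd : p % 2 = 1 := (Fact.out : p.Prime).mod_two_eq_one_iff_ne_two.2 (by omega)
  have h2 : (2 : A k p) = algebraMap k (A k p) 2 := (map_ofNat _ 2).symm
  have h2' : IsUnit (2 : A k p) := by
    rw [h2]
    have h := cast_ne_zero_of_lt (k := k) (p := p) (n := 2) two_ne_zero (by omega)
    exact (IsUnit.mk0 (2 : k) (by exact_mod_cast h)).map _
  constructor
  · intro h
    set f := w (x k p) with hf
    have key (a : A k p) := congrArg (fun D : W k p => D (x k p)) (h (a • partialD k p))
    simp only [bracket_bracket_x, smul_partialD_x, ← hf, Derivation.zero_apply] at key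
    have k0 := key 1
    have k1 := key (x k p)
    have k2 := key (x k p ^ 2)
    simp only [Derivation.map_one_eq_zero, partialD_x, map_zero, pow_two, Derivation.leibniz,
      smul_eq_mul, map_add, mul_one, mul_zero] at k0 k1 k2
    have h0 : f * f = 0 := h2'.mul_right_cancel <| by
      linear_combination k2 - x k p * x k p * k0 - 2 * x k p * (k1 - x k p * k0)
    have h1 : f * partialD k p f = 0 := by linear_combination -k1 + x k p * k0
    have h3 : partialD k p f * partialD k p f = 0 := by
      have := congrArg (partialD k p) h1
      simp only [Derivation.leibniz, smul_eq_mul, map_zero] at this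
      exact h2'.mul_right_cancel (by linear_combination this + k0)
    rw [x_pow_dvd_iff (by omega)]
    intro n
    induction n using Nat.strong_induction_on with
    | _ n ih =>
      intro hn
      by_contra hne
      have hnp : n < p := by omega
      obtain ⟨b, hb, -, hbu⟩ := exists_eq_x_pow_mul hnp (fun m hm => ih m hm (hm.trans hn)) hne
      rcases Nat.eq_zero_or_pos n with rfl | hn0
      · rw [hb, pow_zero, one_mul] at h0
        have := x_pow_mul_unit_eq_zero (m := 0) (hbu.mul hbu) (by rw [h0, mul_zero])
        omega
      · have hd : partialD k p f = x k p ^ (n - 1) * ((n : k) • b + x k p * partialD k p b) := by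
          obtain ⟨m, rfl⟩ : ∃ m, n = m + 1 := ⟨n - 1, by omega⟩
          rw [hb, Derivation.leibniz, partialD_x_pow, Nat.add_sub_cancel, smul_eq_mul,
            smul_eq_mul, mul_add, mul_smul_comm, mul_smul_comm, mul_comm b, pow_succ, mul_assoc,
            add_comm]
        have hu : IsUnit ((n : k) • b + x k p * partialD k p b) := by
          rw [isUnit_iff_coeffA, map_add, map_smul, coeffA_zero_mul (x k p), ← pow_one (x k p),
            coeffA_x_pow prime_pos']
          simpa [cast_ne_zero_of_lt hn0.ne' hnp] using (isUnit_iff_coeffA b).1 hbu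
        have := x_pow_mul_unit_eq_zero (m := 2 * (n - 1)) (hu.mul hu) (by
          rw [← h3, hd]
          ring)
        omega
  · intro h u
    have hd := x_pow_dvd_partialD h
    have hdd := x_pow_dvd_partialD hd
    refine derivation_ext_x ?_
    rw [bracket_bracket_x, pow_two, pow_two, mul_eq_zero_of_x_pow_dvd (by omega) h h,
      mul_eq_zero_of_x_pow_dvd (by omega) h hd, mul_eq_zero_of_x_pow_dvd (by omega) h hdd,
      mul_eq_zero_of_x_pow_dvd (by omega) hd hd]
    simp

omit [Fact p.Prime] [CharP k p] in
theorem isSandwich_map (σ : W k p ≃ₗ⁅k⁆ W k p) {w : W k p} (h : IsSandwich w) :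
    IsSandwich (σ w) := fun u => by
  rw [← σ.apply_symm_apply u, ← LieEquiv.map_lie, ← LieEquiv.map_lie, h, lieEquiv_map_zero]

/-- `W_{≥ 0}` is the normalizer of the set of sandwich elements. -/
theorem coeffA_zero_eq_zero_iff (hp : 3 < p) (u : W k p) :
    coeffA 0 (u (x k p)) = 0 ↔ ∀ w : W k p, IsSandwich w → IsSandwich ⁅u, w⁆ := by
  simp only [isSandwich_iff hp]
  constructor
  · intro h w hw
    have hu : x k p ^ 1 ∣ u (x k p) := (x_pow_dvd_iff (by omega) _).2 fun n hn => by
      obtain rfl : n = 0 := by omega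
      exact h
    rw [bracket_x]
    refine dvd_sub ?_ (hw.mul_right _)
    have := mul_dvd_mul hu (x_pow_dvd_partialD hw)
    rwa [← pow_add, show 1 + ((p + 3) / 2 - 1) = (p + 3) / 2 by omega] at this
  · intro h
    by_contra h0
    have hodd : p % 2 = 1 := (Fact.out : p.Prime).mod_two_eq_one_iff_ne_two.2 (by omega)
    -- With `m = (p + 3) / 2`, bracketing `u` with the sandwich `x^m ∂` produces the term `m u(0)
    -- x^(m-1)`, of too low order. Here `m ≠ 0` in `k` because `m < p`.
    have h1 := h (x k p ^ ((p + 3) / 2) • partialD k p) (by rw [smul_partialD_x])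
    rw [bracket_x, smul_partialD_x, dvd_sub_left (dvd_mul_right _ _),
      x_pow_dvd_iff (by omega)] at h1
    have h2 := h1 ((p + 3) / 2 - 1) (by omega)
    rw [partialD_x_pow, mul_smul_comm, map_smul, mul_comm, coeffA_x_pow_mul (by omega),
      if_pos le_rfl, Nat.sub_self, smul_eq_mul, mul_eq_zero] at h2
    rcases h2 with h2 | h2
    · exact cast_ne_zero_of_lt (by omega) (by omega) h2
    · exact h0 h2

theorem coeffA_zero_map_eq_zero (hp : 3 < p) (σ : W k p ≃ₗ⁅k⁆ W k p) {u : W k p}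
    (h : coeffA 0 (u (x k p)) = 0) : coeffA 0 (σ u (x k p)) = 0 := by
  rw [coeffA_zero_eq_zero_iff hp] at h ⊢
  intro w hw
  have := isSandwich_map σ (h _ (isSandwich_map σ.symm hw))
  rwa [LieEquiv.map_lie, LieEquiv.apply_symm_apply] at this

/-- An automorphism of `W` which fixes `∂` is the identity. -/
theorem eq_of_map_partialD (hp : 3 < p) (τ : W k p ≃ₗ⁅k⁆ W k p)
    (h : τ (partialD k p) = partialD k p) (w : W k p) : τ w = w := by
  have hD (v : W k p) : ⁅partialD k p, v⁆ (x k p) = partialD k p (v (x k p)) := by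
    rw [bracket_x, partialD_x, Derivation.map_one_eq_zero, one_mul, mul_zero, sub_zero]
  refine derivation_ext_x (ext_coeffA fun n => ?_)
  induction n generalizing w with
  | zero =>
    intro _
    -- Subtracting a multiple of the fixed element `∂` brings `w` into `W_{≥ 0}`, which `τ`
    -- preserves.
    have := coeffA_zero_map_eq_zero hp τ (u := w - coeffA 0 (w (x k p)) • partialD k p) (by
      rw [Derivation.sub_apply, Derivation.smul_apply, partialD_x, map_sub, map_smul,
        coeffA_zero_one, smul_eq_mul, mul_one, sub_self])
    rw [lieEquiv_map_sub, lieEquiv_map_smul, h, Derivation.sub_apply, Derivation.smul_apply, partialD_x, map_sub,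
      map_smul, coeffA_zero_one, smul_eq_mul, mul_one] at this
    exact sub_eq_zero.1 this
  | succ n ih =>
    intro hn
    -- Bracketing with `∂` differentiates, so coefficient `n + 1` of `w` is read from coefficient
    -- `n` of the bracket, up to the invertible factor `n + 1`.
    have h1 := ih ⁅partialD k p, w⁆ (by omega)
    rw [LieEquiv.map_lie, h, hD, hD, coeffA_partialD (by omega), coeffA_partialD (by omega)] at h1
    have h2 := cast_ne_zero_of_lt (k := k) (Nat.succ_ne_zero n) hn
    push_cast at h2
    exact mul_left_cancel₀ h2 h1

omit [Fact p.Prime] in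
theorem partialD_inv {g gi : A k p} (h : g * gi = 1) :
    partialD k p gi = - gi ^ 2 * partialD k p g := by
  have := congrArg (partialD k p) h
  rw [Derivation.leibniz, Derivation.map_one_eq_zero, smul_eq_mul, smul_eq_mul] at this
  linear_combination gi * this - partialD k p gi * h

/-- If `y' = b` with `b` a unit, then `y - y(0)` is the image of `x` under an automorphism. -/
theorem exists_algEquiv_of_partialD {y b : A k p} (h : partialD k p y = b) (hb : IsUnit b)
    (h0 : coeffA 0 y = 0) : ∃ φ : A k p ≃ₐ[k] A k p, φ (x k p) = y := by
  have hp := (Fact.out : p.Prime).two_le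
  obtain ⟨u, hu⟩ := (x_pow_dvd_iff (m := 1) (by omega) y).2
    (fun n hn => by obtain rfl : n = 0 := by omega
                    exact h0)
  rw [pow_one] at hu
  have := coeffA_zero_partialD_x_mul u
  rw [← hu, h] at this
  obtain ⟨φ, hφ⟩ := exists_algEquiv u ((isUnit_iff_coeffA u).2
    (this ▸ (isUnit_iff_coeffA b).1 hb))
  exact ⟨φ, hφ.trans hu.symm⟩

/-- For `p > 3` every automorphism of `W` is induced by an automorphism of `A`. -/
theorem exists_eq_adConj (hp : 3 < p) (σ : W k p ≃ₗ⁅k⁆ W k p) :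
    ∃ φ : A k p ≃ₐ[k] A k p, ∀ w, σ w = adConj φ w := by
  have hg : coeffA 0 (σ (partialD k p) (x k p)) ≠ 0 := by
    intro h
    have := coeffA_zero_map_eq_zero hp σ.symm h
    rw [LieEquiv.symm_apply_apply, partialD_x, coeffA_zero_one] at this
    exact one_ne_zero this
  obtain ⟨gi, hgi⟩ := ((isUnit_iff_coeffA _).2 hg).exists_right_inv
  have hgu : IsUnit gi := IsUnit.of_mul_eq_one _ ((mul_comm _ _).trans hgi)
  set g := σ (partialD k p) (x k p) with hgdef
  set s := σ (x k p • partialD k p) (x k p) with hs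
  have hbr : ⁅x k p • partialD k p, partialD k p⁆ = - partialD k p := by
    refine derivation_ext_x ?_
    rw [bracket_x, smul_partialD_x, partialD_x, Derivation.map_one_eq_zero, Derivation.neg_apply,
      partialD_x]
    ring
  have hsg : s * partialD k p g - g * partialD k p s = - g := by
    rw [← bracket_x, ← LieEquiv.map_lie, hbr, lieEquiv_map_neg, Derivation.neg_apply]
  -- A coordinate `y` with `y' = 1/g` is needed, so that conjugation sends `∂` to `g ∂`. An
  -- antiderivative of `1/g` is `s/g`, where `s ∂` is the image of `x ∂`: the relation `[x ∂, ∂] =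
  -- -∂` becomes `s g' - g s' = -g`. The constant is subtracted so that `y(0) = 0`.
  have hy : partialD k p (s * gi - algebraMap k _ (coeffA 0 (s * gi))) = gi := by
    rw [map_sub, Derivation.map_algebraMap, sub_zero, Derivation.leibniz, partialD_inv hgi,
      smul_eq_mul, smul_eq_mul]
    linear_combination (-gi ^ 2) * hsg + (gi - partialD k p s * gi) * hgi
  obtain ⟨φ, hφ⟩ := exists_algEquiv_of_partialD hy hgu (by
    rw [map_sub, Algebra.algebraMap_eq_smul_one, map_smul, coeffA_zero_one, smul_eq_mul, mul_one,
      sub_self])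
  refine ⟨φ, fun w => ?_⟩
  have h1 : adConj φ (partialD k p) = σ (partialD k p) := by
    rw [adConj_eq_iff, partialD_x, map_one, hφ, hy, hgi]
  have h2 := eq_of_map_partialD hp (σ.trans (adConj φ).symm) (by
    rw [LieEquiv.trans_apply, ← h1, LieEquiv.symm_apply_apply]) w
  rw [LieEquiv.trans_apply] at h2
  conv_rhs => rw [← h2, LieEquiv.apply_symm_apply]

/-- The orbit relation in terms of substitutions. -/
theorem mem_orbit_iff (hp : 3 < p) (D E : W k p) :
    E ∈ orbit D ↔ ∃ φ : A k p ≃ₐ[k] A k p,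
      φ (D (x k p)) = E (x k p) * partialD k p (φ (x k p)) := by
  constructor
  · rintro ⟨σ, rfl⟩
    obtain ⟨φ, hφ⟩ := exists_eq_adConj hp σ
    exact ⟨φ, (adConj_eq_iff φ D _).1 (hφ D).symm⟩
  · rintro ⟨φ, hφ⟩
    exact ⟨adConj φ, (adConj_eq_iff φ D E).2 hφ⟩

theorem x_pow_dvd_apply (hp : 3 < p) (σ : W k p ≃ₗ⁅k⁆ W k p) {n : ℕ} {w : W k p}
    (h : x k p ^ n ∣ w (x k p)) : x k p ^ n ∣ σ w (x k p) := by
  obtain ⟨φ, hφ⟩ := exists_eq_adConj hp σ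
  have h1 := (adConj_eq_iff φ w _).1 (hφ w).symm
  have h2 := x_pow_dvd_map φ h
  rwa [h1, (isUnit_partialD_map_x φ).dvd_mul_right] at h2

theorem x_pow_dvd_apply_iff (hp : 3 < p) (σ : W k p ≃ₗ⁅k⁆ W k p) {n : ℕ} (w : W k p) :
    x k p ^ n ∣ σ w (x k p) ↔ x k p ^ n ∣ w (x k p) :=
  ⟨fun h => by simpa using x_pow_dvd_apply hp σ.symm h, x_pow_dvd_apply hp σ⟩

end

end

/-! ### Residues and their behaviour under substitution. -/

section

variable {k : Type*} [Field k] {p : ℕ}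

theorem eq_sum_coeffA (a : A k p) : a = ∑ m ∈ Finset.range p, coeffA m a • x k p ^ m := by
  refine ext_coeffA fun n hn => ?_
  rw [map_sum, Finset.sum_eq_single_of_mem n (Finset.mem_range.2 hn)]
  · rw [map_smul, coeffA_x_pow hn, if_pos rfl, smul_eq_mul, mul_one]
  · intro m _ hm
    rw [map_smul, coeffA_x_pow hn, if_neg hm.symm, smul_zero]

section

variable [Fact p.Prime]

theorem coeffA_zero_algEquiv (φ : A k p ≃ₐ[k] A k p) (a : A k p) :
    coeffA 0 (φ a) = coeffA 0 a := by
  obtain ⟨b, hb⟩ := eq_algebraMap_add a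
  obtain ⟨u, hu, -⟩ := algEquiv_x φ
  conv_lhs => rw [hb]
  rw [map_add, map_mul, hu, AlgEquiv.commutes, map_add, mul_assoc, ← pow_one (x k p),
    coeffA_x_pow_mul prime_pos', if_neg (by omega), add_zero, Algebra.algebraMap_eq_smul_one,
    map_smul, coeffA_zero_one, smul_eq_mul, mul_one]

theorem x_pow_pred_mul (a : A k p) : x k p ^ (p - 1) * a = coeffA 0 a • x k p ^ (p - 1) := by
  have hp := prime_pos' (p := p)
  refine ext_coeffA fun n hn => ?_
  rw [coeffA_x_pow_mul hn, map_smul, coeffA_x_pow hn]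
  rcases eq_or_ne n (p - 1) with rfl | h
  · simp
  · rw [if_neg (by omega), if_neg h, smul_zero]

variable [CharP k p]

/-- Up to the constant `u^p`, this is the residue of `y^(-q-1) dy` for `y = x u`. For `q > 0` the
form is exact: after multiplication by `p - q` the coefficient becomes `(p - q) + q = 0` times that
of `u^(p-q)`. For `q = 0` it is the logarithmic form `dy/y`. -/
theorem coeffA_partialD_x_mul_mul_pow {q : ℕ} (hq : q < p) (u : A k p) :
    coeffA q (partialD k p (x k p * u) * u ^ (p - q - 1)) =
      if q = 0 then coeffA 0 u ^ p else 0 := by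
  rcases Nat.eq_zero_or_pos q with rfl | hq0
  · rw [if_pos rfl, coeffA_zero_mul, coeffA_zero_partialD_x_mul, coeffA_zero_pow, ← pow_succ']
    congr 1
    omega
  · rw [if_neg hq0.ne']
    have he : ((p - q : ℕ) : k) ≠ 0 := cast_ne_zero_of_lt (by omega) (by omega)
    have h1 : ((p - q : ℕ) : k) • (partialD k p (x k p * u) * u ^ (p - q - 1)) =
        ((p - q : ℕ) : k) • u ^ (p - q) + x k p ^ 1 * partialD k p (u ^ (p - q)) := by
      rw [Derivation.leibniz, Derivation.leibniz_pow, partialD_x, Nat.cast_smul_eq_nsmul,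
        Nat.cast_smul_eq_nsmul, show p - q = p - q - 1 + 1 by omega]
      simp only [smul_eq_mul, nsmul_eq_mul, Nat.add_sub_cancel]
      ring
    have h2 := congrArg (coeffA q) h1
    rw [map_smul, map_add, map_smul, coeffA_x_pow_mul hq, if_pos (by omega),
      coeffA_partialD (by omega), ← Nat.cast_succ, Nat.succ_eq_add_one,
      Nat.sub_add_cancel hq0, smul_eq_mul, smul_eq_mul, ← add_mul, ← Nat.cast_add,
      Nat.sub_add_cancel hq.le, CharP.cast_eq_zero k p, zero_mul] at h2
    exact (mul_eq_zero.1 h2).resolve_left he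

/-- Invariance of the residue under substitution. -/
theorem coeffA_substitution (φ : A k p ≃ₐ[k] A k p) {u : A k p} (hu : φ (x k p) = x k p * u)
    {N : ℕ} (hN : 1 ≤ N) (hNp : N ≤ p) (K : A k p) :
    coeffA (N - 1) (partialD k p (x k p * u) * u ^ (p - N) * φ K) =
      coeffA 0 u ^ p * coeffA (N - 1) K := by
  conv_lhs => rw [eq_sum_coeffA K]
  -- Expanding `K` in monomials, only the one of exponent `N - 1` has a nonzero residue.
  rw [map_sum, Finset.mul_sum, map_sum,
    Finset.sum_eq_single_of_mem (N - 1) (Finset.mem_range.2 (by omega))]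
  all_goals
    try intro m hm hne
    rw [map_smul, map_pow, hu, mul_smul_comm, map_smul, mul_pow, mul_left_comm,
      coeffA_x_pow_mul (by omega)]
  · rw [if_pos le_rfl, Nat.sub_self, mul_assoc, ← pow_add, smul_eq_mul, mul_comm,
      show p - N + (N - 1) = p - 0 - 1 by omega, coeffA_partialD_x_mul_mul_pow prime_pos',
      if_pos rfl]
  · split_ifs with h
    · rw [mul_assoc, ← pow_add, show p - N + m = p - (N - 1 - m) - 1 by omega,
        coeffA_partialD_x_mul_mul_pow (by omega), if_neg (by omega), smul_zero]
    · rw [smul_zero]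

/-- The hypothesis amounts to `1/g = y' φ(1/f)`, to which the residue formula with `N = p` applies.
-/
theorem coeffA_inv_of_unit (φ : A k p ≃ₐ[k] A k p) {f fi g gi u : A k p}
    (hu : φ (x k p) = x k p * u) (hf : f * fi = 1) (hg : g * gi = 1)
    (h : φ f = g * partialD k p (φ (x k p))) :
    coeffA (p - 1) gi = coeffA 0 u ^ p * coeffA (p - 1) fi ∧
      coeffA 0 gi = coeffA 0 u * coeffA 0 fi := by
  have h1 : gi = partialD k p (x k p * u) * φ fi := by
    have h2 : φ f * φ fi = 1 := by rw [← map_mul, hf, map_one]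
    rw [← hu]
    linear_combination (-gi) * h2 + gi * φ fi * h + φ fi * partialD k p (φ (x k p)) * hg
  have hp := prime_pos' (p := p)
  constructor
  · have := coeffA_substitution φ hu hp le_rfl fi
    rwa [Nat.sub_self, pow_zero, mul_one, ← h1] at this
  · rw [h1, coeffA_zero_mul, coeffA_zero_partialD_x_mul, coeffA_zero_algEquiv]

/-- Invariance of the residue of `dx/(x^n f)`. The identity `1/g = y' u^(-n) φ(1/f)` is available
only after multiplication by `x^n`, so coefficients are compared at exponent `2n - 1`; this must be
below `p`, whence `2n ≤ p`. -/
theorem coeffA_inv_of_x_pow (φ : A k p ≃ₐ[k] A k p) {n : ℕ} (hn : 1 ≤ n) (hnp : 2 * n ≤ p)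
    {f fi g gi : A k p} (hf : f * fi = 1) (hg : g * gi = 1)
    (h : φ (x k p ^ n * f) = x k p ^ n * g * partialD k p (φ (x k p))) :
    coeffA (n - 1) gi = coeffA (n - 1) fi := by
  obtain ⟨u, hu, hu'⟩ := algEquiv_x φ
  have h2 : φ f * φ fi = 1 := by rw [← map_mul, hf, map_one]
  have h3 : u ^ n * u ^ (p - n) = algebraMap k _ (coeffA 0 u ^ p) := by
    rw [← pow_add, ← pow_p]
    congr 1
    omega
  rw [map_mul, map_pow, hu, mul_pow] at h
  have h4 : x k p ^ n * (algebraMap k _ (coeffA 0 u ^ p) * gi) =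
      x k p ^ n * (partialD k p (x k p * u) * u ^ (p - n) * φ fi) := by
    linear_combination φ fi * gi * u ^ (p - n) * h - x k p ^ n * gi * h3
      - x k p ^ n * u ^ n * u ^ (p - n) * gi * h2
      + x k p ^ n * partialD k p (x k p * u) * u ^ (p - n) * φ fi * hg
  have h5 := congrArg (coeffA (2 * n - 1)) h4
  rw [coeffA_x_pow_mul (by omega), coeffA_x_pow_mul (by omega), if_pos (by omega),
    show 2 * n - 1 - n = n - 1 by omega, coeffA_substitution φ hu hn (by omega),
    ← smul_eq_algebraMap_mul, map_smul, smul_eq_mul, if_pos (by omega)] at h5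
  exact mul_left_cancel₀ (pow_ne_zero _ ((isUnit_iff_coeffA u).1 hu')) h5

theorem mem_orbit_iff_of_degree_neg_one (hp : 3 < p) (a : k) (w : W k p) :
    w ∈ orbit ((1 + a • x k p ^ (p - 1)) • partialD k p) ↔
      ∃ gi, w (x k p) * gi = 1 ∧ coeffA (p - 1) gi = -a * coeffA 0 gi ^ p := by
  have hx : x k p ^ (p - 1) * x k p ^ (p - 1) = 0 :=
    mul_eq_zero_of_x_pow_dvd (by omega) (dvd_refl _) (dvd_refl _)
  have hinv : (1 + a • x k p ^ (p - 1)) * (1 - a • x k p ^ (p - 1)) = 1 := by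
    rw [mul_sub, mul_one, mul_smul_comm, add_mul, one_mul, smul_mul_assoc, hx, smul_zero, add_zero,
      add_sub_cancel_right]
  have hc0 : coeffA 0 (1 - a • x k p ^ (p - 1)) = 1 := by
    rw [map_sub, map_smul, coeffA_zero_one, coeffA_x_pow (by omega), if_neg (by omega)]
    simp
  have hcp : coeffA (p - 1) (1 - a • x k p ^ (p - 1)) = -a := by
    rw [map_sub, map_smul, coeffA_one (by omega), coeffA_x_pow (by omega), if_neg (by omega)]
    simp
  rw [mem_orbit_iff hp, smul_partialD_x]
  constructor
  · rintro ⟨φ, h⟩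
    obtain ⟨u, hu, hu'⟩ := algEquiv_x φ
    have hw : IsUnit (w (x k p)) := by
      have := ((IsUnit.of_mul_eq_one _ hinv).map φ)
      rw [h] at this
      exact isUnit_of_mul_isUnit_left this
    obtain ⟨gi, hgi⟩ := hw.exists_right_inv
    obtain ⟨h1, h2⟩ := coeffA_inv_of_unit φ hu hinv hgi h
    refine ⟨gi, hgi, ?_⟩
    rw [h1, h2, hc0, hcp, mul_one, mul_comm]
  · rintro ⟨gi, hgi, h⟩
    have hgu : coeffA 0 gi ≠ 0 := (isUnit_iff_coeffA gi).1 (IsUnit.of_mul_eq_one_right _ hgi)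
    set b := coeffA 0 gi
    have hb : coeffA 0 (gi + (a * b ^ p) • x k p ^ (p - 1)) = b := by
      rw [map_add, map_smul, coeffA_x_pow (by omega), if_neg (by omega), smul_zero, add_zero]
    -- The equation to solve is `y' (1 - a y^(p-1)) = 1/g`. Since `y^(p-1) y' = b^p x^(p-1)` for `b
    -- = y'(0)`, it reads `y' = 1/g + a b^p x^(p-1)`. The hypothesis says precisely that the right
    -- side has no term in `x^(p-1)`, so it is a derivative.
    obtain ⟨y, hy, hy0⟩ := exists_partialD_eq (a := gi + (a * b ^ p) • x k p ^ (p - 1)) (by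
      rw [map_add, map_smul, coeffA_x_pow (by omega), if_pos rfl, h, smul_eq_mul]
      ring)
    obtain ⟨φ, hφ⟩ := exists_algEquiv_of_partialD hy ((isUnit_iff_coeffA _).2 (by rwa [hb])) hy0
    refine ⟨φ, ?_⟩
    obtain ⟨u, hu, -⟩ := algEquiv_x φ
    have hub : coeffA 0 u = b := by
      rw [← coeffA_zero_partialD_x_mul, ← hu, hφ, hy, hb]
    have h1 : y ^ (p - 1) * partialD k p y = b ^ p • x k p ^ (p - 1) := by
      rw [hy, ← hφ, hu, mul_pow, mul_assoc, x_pow_pred_mul, coeffA_zero_mul, coeffA_zero_pow, hb,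
        hub, ← pow_succ, Nat.sub_add_cancel (by omega)]
    have h2 : gi = partialD k p y * φ (1 - a • x k p ^ (p - 1)) := by
      rw [map_sub, map_one, map_smul, map_pow, hφ, mul_sub, mul_smul_comm, mul_comm _ (y ^ _), h1,
        hy, smul_smul]
      ring
    have h3 := congrArg φ hinv
    rw [map_mul, map_one] at h3
    rw [hφ]
    linear_combination (-φ (1 + a • x k p ^ (p - 1))) * hgi
      + φ (1 + a • x k p ^ (p - 1)) * w (x k p) * h2 + w (x k p) * partialD k p y * h3

/-! ### Normal forms by successive substitutions. -/

omit [Fact p.Prime] [CharP k p] in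
theorem x_pow_dvd_map_sub (φ : A k p ≃ₐ[k] A k p) {m : ℕ} (h : x k p ^ m ∣ φ (x k p) - x k p)
    (a : A k p) : x k p ^ m ∣ φ a - a := by
  obtain ⟨F, rfl⟩ := mkA_surjective a
  rw [algEquiv_mkA, mkA_eq_aeval, ← eval_map_algebraMap, ← eval_map_algebraMap]
  exact h.trans (sub_dvd_eval_sub _ _ _)

theorem exists_one_add_pow_eq {R : Type*} [CommRing R] (t : R) (n : ℕ) :
    ∃ r, (1 + t) ^ n = 1 + n * t + t ^ 2 * r := by
  induction n with
  | zero => exact ⟨0, by simp⟩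
  | succ n ih =>
    obtain ⟨r, hr⟩ := ih
    refine ⟨n + r + t * r, ?_⟩
    rw [pow_succ, hr]
    push_cast
    ring

/-- The substitution `x ↦ x + t x^(j+1)` changes a coefficient of an element of order `n` by
a multiple of `n - 1 - j`. -/
theorem exists_mem_orbit_coeffA_eq {w : W k p} {n j : ℕ} (hn : x k p ^ n ∣ w (x k p))
    (hc : coeffA n (w (x k p)) ≠ 0) (hj : 1 ≤ j) (hnj : n + j < p)
    (hne : (n : k) - 1 - j ≠ 0) (s : k) :
    ∃ v ∈ orbit w, (∀ q < n + j, coeffA q (v (x k p)) = coeffA q (w (x k p))) ∧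
      coeffA (n + j) (v (x k p)) = s := by
  set g := w (x k p) with hg
  set c := coeffA n g with hcdef
  -- To first order, substituting in `g` adds `n t c` at exponent `n + j`, and dividing by `y' = 1 +
  -- (j + 1) t x^j` subtracts `(j + 1) t c`. So `t` solves a linear equation with slope `(n - 1 - j)
  -- c`.
  obtain ⟨t, ht⟩ : ∃ t : k, coeffA (n + j) g + (n - 1 - j) * t * c = s :=
    ⟨(s - coeffA (n + j) g) / ((n - 1 - j) * c), by field_simp; ring⟩
  obtain ⟨i, rfl⟩ : ∃ i, j = i + 1 := ⟨j - 1, by omega⟩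
  set τ := algebraMap k (A k p) t with hτ
  set γ := algebraMap k (A k p) c with hγ
  have hu : IsUnit (1 + τ * x k p ^ (i + 1)) := by
    rw [isUnit_iff_coeffA, map_add, coeffA_zero_one, ← smul_eq_algebraMap_mul, map_smul,
      coeffA_x_pow prime_pos', if_neg (by omega)]
    simp
  obtain ⟨φ, hφ⟩ := exists_algEquiv _ hu
  have hdy : partialD k p (φ (x k p)) = 1 + ((i + 1 : ℕ) + 1) * τ * x k p ^ (i + 1) := by
    rw [hφ, mul_add, mul_one, map_add, partialD_x, mul_left_comm, ← pow_succ',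
      ← smul_eq_algebraMap_mul, partialD_smul, partialD_x_pow, smul_smul, Nat.add_sub_cancel,
      smul_eq_algebraMap_mul, map_mul,
      map_natCast]
    push_cast
    ring
  set v := adConj φ w with hv
  have hvx := (adConj_eq_iff φ w v).1 rfl
  obtain ⟨h, hh⟩ := hn
  have hh0 : coeffA 0 h = c := by
    rw [hcdef, hh, coeffA_x_pow_mul (by omega), if_pos le_rfl, Nat.sub_self]
  obtain ⟨h', hh'⟩ := eq_algebraMap_add h
  rw [hh0, ← hγ] at hh'
  obtain ⟨r₁, hr₁⟩ := x_pow_dvd_map_sub φ (m := i + 2) ⟨τ, by rw [hφ]; ring⟩ h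
  rw [sub_eq_iff_eq_add] at hr₁
  obtain ⟨r₂, hr₂⟩ := exists_one_add_pow_eq (τ * x k p ^ (i + 1)) n
  obtain ⟨r, h1⟩ : ∃ r, φ g =
      g + n * τ * γ * x k p ^ (n + (i + 1)) + x k p ^ (n + (i + 1) + 1) * r := by
    refine ⟨n * τ * h' + r₁ + n * τ * x k p ^ (i + 1) * r₁ + τ ^ 2 * x k p ^ i * r₂ * φ h, ?_⟩
    rw [hh, map_mul, map_pow, hφ, mul_pow, hr₂, hr₁, hh']
    ring
  have h2 : x k p ^ (n + (i + 1) + 1) ∣ partialD k p (φ (x k p)) *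
      (v (x k p) - (g + (((n : k) - 1 - (i + 1 : ℕ)) * t * c) • x k p ^ (n + (i + 1)))) := by
    have : (((n : k) - 1 - (i + 1 : ℕ)) * t * c) • x k p ^ (n + (i + 1)) =
        (n - 1 - (i + 1 : ℕ)) * τ * γ * x k p ^ (n + (i + 1)) := by
      rw [smul_eq_algebraMap_mul]
      simp [hτ, hγ]
    rw [this, mul_sub, mul_comm _ (v _), ← hvx, h1, hdy, hh, hh']
    refine ⟨r - (((i + 1 : ℕ) + 1) * τ * h' + ((i + 1 : ℕ) + 1) * (n - 1 - (i + 1 : ℕ)) * τ ^ 2 * γ *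
        x k p ^ i), ?_⟩
    ring
  rw [(isUnit_partialD_map_x φ).dvd_mul_left, x_pow_dvd_iff_coeffA_sub (by omega)] at h2
  refine ⟨v, ⟨adConj φ, rfl⟩, fun q hq => ?_, ?_⟩
  · rw [h2 q (by omega), map_add, map_smul, coeffA_x_pow (by omega), if_neg (by omega), smul_zero,
      add_zero]
  · rw [h2 _ (by omega), map_add, map_smul, coeffA_x_pow (by omega), if_pos rfl, smul_eq_mul,
      mul_one, ht]

/-- Terms are normalized one exponent at a time. As `n - 1 - j` lies strictly between `-p` and `p`,
it vanishes in `k` only for `j = n - 1`, where the term of exponent `2n - 1` is kept as `a`. For `n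
= 1` this would be `j = 0`, which does not occur, so `a = 0`. -/
theorem exists_mem_orbit_coeffA_eq_binomial {w : W k p} {n : ℕ} (hn1 : 1 ≤ n)
    (hn : x k p ^ n ∣ w (x k p)) (hc : coeffA n (w (x k p)) ≠ 0) {j : ℕ} (hj : 1 ≤ j)
    (hnj : n + j ≤ p) :
    ∃ a : k, (n = 1 → a = 0) ∧ ∃ v ∈ orbit w, ∀ q < n + j, coeffA q (v (x k p)) =
      coeffA q (coeffA n (w (x k p)) • x k p ^ n + a • x k p ^ (2 * n - 1)) := by
  induction j, hj using Nat.le_induction with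
  | base =>
    refine ⟨0, fun _ => rfl, w, mem_orbit_self w, fun q hq => ?_⟩
    rw [zero_smul, add_zero, map_smul, coeffA_x_pow (by omega)]
    rcases eq_or_ne q n with rfl | h
    · simp
    · rw [if_neg h, smul_zero]
      exact (x_pow_dvd_iff (by omega) _).1 hn q (by omega)
  | succ j hj ih =>
    obtain ⟨a, ha, v, hv, hq⟩ := ih (by omega)
    by_cases hjn : j = n - 1
    · refine ⟨coeffA (2 * n - 1) (v (x k p)), by omega, v, hv, fun q hq' => ?_⟩
      rw [map_add, map_smul, map_smul, coeffA_x_pow (by omega), coeffA_x_pow (by omega)]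
      rcases eq_or_ne q (2 * n - 1) with rfl | h
      · rw [if_neg (by omega)]
        simp
      · rw [hq q (by omega), map_add, map_smul, map_smul, coeffA_x_pow (by omega),
          coeffA_x_pow (by omega), if_neg h]
        simp
    · have hq1 (q : ℕ) (h : q ≤ n) : coeffA q (v (x k p)) = coeffA q (w (x k p)) := by
        rw [hq q (by omega), map_add, map_smul, map_smul, coeffA_x_pow (by omega),
          coeffA_x_pow (by omega)]
        rcases eq_or_ne q n with rfl | h'
        · rcases eq_or_ne q 1 with h1 | h1
          · simp [ha h1]
          · rw [if_neg (by omega : q ≠ 2 * q - 1)]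
            simp
        · rw [if_neg h', if_neg (by omega), (x_pow_dvd_iff (by omega) _).1 hn q (by omega)]
          simp
      have hne : (n : k) - 1 - j ≠ 0 := by
        rcases Nat.lt_or_gt_of_ne hjn with h | h
        · have := cast_ne_zero_of_lt (k := k) (p := p) (n := n - 1 - j) (by omega) (by omega)
          rwa [Nat.cast_sub (by omega), Nat.cast_sub hn1, Nat.cast_one] at this
        · have := cast_ne_zero_of_lt (k := k) (p := p) (n := j - (n - 1)) (by omega) (by omega)
          rw [Nat.cast_sub (by omega), Nat.cast_sub hn1, Nat.cast_one, sub_ne_zero] at this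
          exact sub_ne_zero.2 this.symm
      obtain ⟨v', hv', h1, h2⟩ := exists_mem_orbit_coeffA_eq (w := v) (n := n) (j := j)
        ((x_pow_dvd_iff (by omega) _).2 fun q h => by
          rw [hq1 q h.le, (x_pow_dvd_iff (by omega) _).1 hn q h])
        (by rwa [hq1 n le_rfl]) hj (by omega) hne
        (coeffA (n + j) (coeffA n (w (x k p)) • x k p ^ n + a • x k p ^ (2 * n - 1)))
      refine ⟨a, ha, v', mem_orbit_trans hv' hv, fun q hq' => ?_⟩
      rcases (Nat.lt_succ_iff.1 hq').lt_or_eq with h | rfl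
      · rw [h1 q h, hq q h]
      · exact h2

theorem exists_mem_orbit_binomial {w : W k p} {n : ℕ} (hn1 : 1 ≤ n) (hnp : n < p)
    (hn : x k p ^ n ∣ w (x k p)) (hc : coeffA n (w (x k p)) ≠ 0) :
    ∃ a : k, (n = 1 → a = 0) ∧ w ∈ orbit
      ((coeffA n (w (x k p)) • x k p ^ n + a • x k p ^ (2 * n - 1)) • partialD k p) := by
  obtain ⟨a, ha, v, hv, h⟩ := exists_mem_orbit_coeffA_eq_binomial hn1 hn hc (j := p - n)
    (by omega) (by omega)
  refine ⟨a, ha, mem_orbit_symm ?_⟩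
  convert hv
  refine derivation_ext_x (ext_coeffA fun q hq => ?_)
  rw [smul_partialD_x, h q (by omega)]

theorem exists_mem_orbit_monic_binomial [IsAlgClosed k] {w : W k p} {n : ℕ} (hn1 : 2 ≤ n)
    (hnp : n < p) (hn : x k p ^ n ∣ w (x k p)) (hc : coeffA n (w (x k p)) ≠ 0) :
    ∃ a : k, w ∈ orbit ((x k p ^ n + a • x k p ^ (2 * n - 1)) • partialD k p) := by
  obtain ⟨a, -, ha⟩ := exists_mem_orbit_binomial (by omega) hnp hn hc
  set c := coeffA n (w (x k p))
  -- Scaling `x ↦ t x` multiplies the leading coefficient by `t^(n-1)`; a root exists because `n ≥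
  -- 2`. The second coefficient acquires the factor `t^(2(n-1))`.
  obtain ⟨t, ht⟩ := IsAlgClosed.exists_pow_nat_eq c⁻¹ (n := n - 1) (by omega)
  have ht0 : t ≠ 0 := by
    rintro rfl
    rw [zero_pow (by omega)] at ht
    exact inv_ne_zero hc ht.symm
  obtain ⟨φ, hφ⟩ := exists_algEquiv (algebraMap k (A k p) t) ((IsUnit.mk0 t ht0).map _)
  rw [mul_comm, ← smul_eq_algebraMap_mul] at hφ
  refine ⟨a * t ^ (2 * (n - 1)), mem_orbit_trans ha (mem_orbit_symm ⟨adConj φ, ?_⟩)⟩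
  change adConj φ _ = _
  rw [adConj_eq_iff, smul_partialD_x, smul_partialD_x, hφ, partialD_smul, partialD_x, map_add,
    map_smul, map_smul, map_pow, map_pow, hφ, _root_.smul_pow, _root_.smul_pow, mul_smul_comm, mul_one,
    smul_add, smul_smul, smul_smul, smul_smul]
  have h1 : t * (a * t ^ (2 * (n - 1))) = a * t ^ (2 * n - 1) := by
    rw [show 2 * n - 1 = 2 * (n - 1) + 1 by omega, pow_succ]
    ring
  have h2 : c * t ^ n = t := by
    rw [show n = n - 1 + 1 by omega, pow_succ, ht, ← mul_assoc, mul_inv_cancel₀ hc, one_mul]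
  rw [h1, h2]

/-! ### Equations for the orbits of each degree. -/

theorem mem_orbit_iff_of_degree_zero (hp : 3 < p) {a : k} (ha : a ≠ 0) (w : W k p) :
    w ∈ orbit ((a • x k p) • partialD k p) ↔
      coeffA 0 (w (x k p)) = 0 ∧ coeffA 1 (w (x k p)) = a := by
  constructor
  · rintro ⟨σ, rfl⟩
    change coeffA 0 (σ _ (x k p)) = 0 ∧ coeffA 1 (σ _ (x k p)) = a
    have h1 : x k p ^ 1 ∣ σ ((a • x k p) • partialD k p) (x k p) := by
      rw [x_pow_dvd_apply_iff hp, smul_partialD_x]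
      exact x_pow_dvd_smul (by rw [pow_one]) a
    obtain ⟨φ, hφ⟩ := exists_eq_adConj hp σ
    have h2 := (adConj_eq_iff φ _ _).1 (hφ ((a • x k p) • partialD k p)).symm
    refine ⟨(x_pow_dvd_iff (by omega) _).1 h1 0 one_pos, ?_⟩
    obtain ⟨b, hb⟩ := h1
    obtain ⟨u, hu, hu'⟩ := algEquiv_x φ
    have h3 : a • (x k p ^ 1 * u) = x k p ^ 1 * (b * partialD k p (x k p * u)) := by
      rw [hb, smul_partialD_x, map_smul, hu] at h2
      rw [pow_one] at h2 ⊢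
      rw [h2, mul_assoc]
    have h4 := congrArg (coeffA 1) h3
    rw [map_smul, coeffA_x_pow_mul (by omega), coeffA_x_pow_mul (by omega), if_pos le_rfl,
      Nat.sub_self, coeffA_zero_mul, coeffA_zero_partialD_x_mul] at h4
    rw [hb, coeffA_x_pow_mul (by omega), if_pos le_rfl, Nat.sub_self]
    exact (mul_right_cancel₀ ((isUnit_iff_coeffA u).1 hu') h4).symm
  · rintro ⟨h0, rfl⟩
    obtain ⟨b, hb, h⟩ := exists_mem_orbit_binomial (w := w) le_rfl (by omega)
      ((x_pow_dvd_iff (by omega) _).2 fun n hn => by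
        obtain rfl : n = 0 := by omega
        exact h0) ha
    rwa [hb rfl, zero_smul, add_zero, pow_one] at h

theorem order_of_mem_orbit (hp : 3 < p) {v w : W k p} (h : w ∈ orbit v) {n : ℕ} (hn : n < p)
    (hv : x k p ^ n ∣ v (x k p)) (hv' : coeffA n (v (x k p)) ≠ 0) :
    x k p ^ n ∣ w (x k p) ∧ coeffA n (w (x k p)) ≠ 0 := by
  obtain ⟨σ, rfl⟩ := h
  change x k p ^ n ∣ σ v (x k p) ∧ coeffA n (σ v (x k p)) ≠ 0
  have h1 := (x_pow_dvd_apply_iff hp σ (n := n) v).2 hv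
  refine ⟨h1, fun h0 => hv' ?_⟩
  have h2 := (x_pow_dvd_apply_iff hp σ (n := n + 1) v).1
  rw [x_pow_dvd_iff (by omega), x_pow_dvd_iff (by omega)] at h2
  rw [x_pow_dvd_iff (by omega)] at h1
  exact h2 (fun q hq => (Nat.lt_succ_iff.1 hq).lt_or_eq.elim (h1 q) fun h => h ▸ h0) n (by omega)

omit [CharP k p] in
theorem coeffA_inv_one_add {a : k} {n : ℕ} (hn : 1 ≤ n) (hnp : n < p) {b : A k p}
    (h : (1 + a • x k p ^ n) * b = 1) : coeffA n b = -a := by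
  have h0 := congrArg (coeffA 0) h
  have hn' := congrArg (coeffA n) h
  rw [coeffA_zero_mul, map_add, map_smul, coeffA_zero_one, coeffA_x_pow prime_pos',
    if_neg (by omega), smul_zero, add_zero, one_mul] at h0
  rw [add_mul, one_mul, map_add, smul_mul_assoc, map_smul, coeffA_x_pow_mul hnp, if_pos le_rfl,
    Nat.sub_self, h0, coeffA_one hnp, if_neg (by omega), smul_eq_mul, mul_one] at hn'
  exact eq_neg_of_add_eq_zero_left hn'

/-- The normal form puts `w` in the orbit of some parameter `b`, and the invariant residue forces `b
= a`. The residue of the representative is `-a` because `1/(1 + a x^(n-1))` has coefficient `-a` at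
`x^(n-1)`. -/
theorem mem_orbit_iff_of_degree_small [IsAlgClosed k] (hp : 3 < p) {n : ℕ} (hn : 2 ≤ n)
    (hnp : 2 * n ≤ p) (a : k) (w : W k p) :
    w ∈ orbit ((x k p ^ n + a • x k p ^ (2 * n - 1)) • partialD k p) ↔
      ∃ h hi, w (x k p) = x k p ^ n * h ∧ h * hi = 1 ∧ coeffA (n - 1) hi = -a := by
  have hfac (b : k) : x k p ^ n + b • x k p ^ (2 * n - 1) =
      x k p ^ n * (1 + b • x k p ^ (n - 1)) := by
    rw [mul_add, mul_one, mul_smul_comm, ← pow_add, show n + (n - 1) = 2 * n - 1 by omega]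
  have hinv (b : k) : ∃ c, (1 + b • x k p ^ (n - 1)) * c = 1 := by
    refine IsUnit.exists_right_inv ((isUnit_iff_coeffA _).2 ?_)
    rw [map_add, coeffA_zero_one, map_smul, coeffA_x_pow (by omega), if_neg (by omega), smul_zero,
      add_zero]
    exact one_ne_zero
  have hres {b : k} {v : W k p}
      (hv : v ∈ orbit ((x k p ^ n + b • x k p ^ (2 * n - 1)) • partialD k p)) {h hi : A k p}
      (hvh : v (x k p) = x k p ^ n * h) (hhi : h * hi = 1) : coeffA (n - 1) hi = -b := by
    obtain ⟨φ, hφ⟩ := (mem_orbit_iff hp _ _).1 hv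
    obtain ⟨c, hc⟩ := hinv b
    rw [smul_partialD_x, hfac, hvh] at hφ
    rw [coeffA_inv_of_x_pow φ (by omega) hnp hc hhi hφ, coeffA_inv_one_add (by omega) (by omega) hc]
  constructor
  · intro hw
    obtain ⟨h1, h2⟩ := order_of_mem_orbit hp hw (n := n) (by omega)
      (by rw [smul_partialD_x, hfac]; exact dvd_mul_right _ _)
      (by
        rw [smul_partialD_x, map_add, map_smul, coeffA_x_pow (by omega), if_pos rfl,
          coeffA_x_pow (by omega), if_neg (by omega), smul_zero, add_zero]
        exact one_ne_zero)
    obtain ⟨h, hh, -, hu⟩ := exists_eq_x_pow_mul (by omega) ((x_pow_dvd_iff (by omega) _).1 h1) h2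
    obtain ⟨hi, hhi⟩ := hu.exists_right_inv
    exact ⟨h, hi, hh, hhi, hres hw hh hhi⟩
  · rintro ⟨h, hi, hh, hhi, hc⟩
    have h0 : coeffA n (w (x k p)) ≠ 0 := by
      rw [hh, coeffA_x_pow_mul (by omega), if_pos le_rfl, Nat.sub_self]
      exact (isUnit_iff_coeffA h).1 (IsUnit.of_mul_eq_one _ hhi)
    obtain ⟨b, hb⟩ := exists_mem_orbit_monic_binomial hn (by omega) (hh ▸ dvd_mul_right _ _) h0
    have := hres hb hh hhi
    rw [hc, neg_inj] at this
    rwa [this]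

theorem mem_orbit_iff_of_degree_large [IsAlgClosed k] (hp : 3 < p) {n : ℕ} (hn : p < 2 * n)
    (hnp : n < p) (w : W k p) :
    w ∈ orbit (x k p ^ n • partialD k p) ↔
      x k p ^ n ∣ w (x k p) ∧ coeffA n (w (x k p)) ≠ 0 := by
  constructor
  · intro hw
    refine order_of_mem_orbit hp hw hnp (by rw [smul_partialD_x]) ?_
    rw [smul_partialD_x, coeffA_x_pow hnp, if_pos rfl]
    exact one_ne_zero
  · rintro ⟨h1, h2⟩
    obtain ⟨b, hb⟩ := exists_mem_orbit_monic_binomial (by omega) hnp h1 h2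
    -- Here `2n - 1 ≥ p`, so the second term of the normal form is zero.
    rwa [show 2 * n - 1 = p + (2 * n - 1 - p) by omega, pow_add, x_pow_p, zero_mul, smul_zero,
      add_zero] at hb

theorem hasDegree_iff {n : ℕ} (hn : n < p) (w : W k p) :
    HasDegree w ((n : ℤ) - 1) ↔ x k p ^ n ∣ w (x k p) ∧ coeffA n (w (x k p)) ≠ 0 := by
  rw [HasDegree, mem_filtration_iff hn.le, show (n : ℤ) - 1 + 1 = ((n + 1 : ℕ) : ℤ) - 1 by
    push_cast; ring, mem_filtration_iff (by omega)]
  refine and_congr_right fun h => not_congr ?_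
  rw [x_pow_dvd_iff (by omega)] at h ⊢
  exact ⟨fun h' => h' n (by omega), fun h' q hq =>
    (Nat.lt_succ_iff.1 hq).lt_or_eq.elim (h q) fun e => e ▸ h'⟩

end

end

/-! ### The Zariski topology on affine space and its dimension. -/

section

section Zariski

variable {k : Type*} [Field k]

section

variable {V V' : Type*} [AddCommGroup V] [Module k V] [AddCommGroup V'] [Module k V']

theorem zariski_isClosed_iff {Z : Set V} :
    @IsClosed V (zariskiTopology k V) Z ↔ ∃ S : Set (V → k), S ⊆ polyFun k V ∧ Z = zeros S := by
  let _ := zariskiTopology k V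
  rw [← isOpen_compl_iff]
  change Zᶜᶜ ∈ _ ↔ _
  rw [compl_compl]
  rfl

theorem zariski_isClosed_zeros {S : Set (V → k)} (hS : S ⊆ polyFun k V) :
    @IsClosed V (zariskiTopology k V) (zeros S) :=
  zariski_isClosed_iff.2 ⟨S, hS, rfl⟩

theorem zariski_isOpen_ne {F : V → k} (hF : F ∈ polyFun k V) :
    @IsOpen V (zariskiTopology k V) {v | F v ≠ 0} := by
  let _ := zariskiTopology k V
  have := zariski_isClosed_zeros (k := k) (S := {F}) (by simpa using hF)
  rw [← isClosed_compl_iff]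
  convert this using 1
  ext v
  simp [zeros]

theorem zariski_continuous {f : V → V'} (hf : ∀ G ∈ polyFun k V', G ∘ f ∈ polyFun k V) :
    @Continuous V V' (zariskiTopology k V) (zariskiTopology k V') f := by
  let _ := zariskiTopology k V
  let _ := zariskiTopology k V'
  rw [continuous_iff_isClosed]
  intro Z hZ
  obtain ⟨S, hS, rfl⟩ := zariski_isClosed_iff.1 hZ
  refine zariski_isClosed_iff.2 ⟨(fun G => G ∘ f) '' S, ?_, ?_⟩
  · rintro _ ⟨G, hG, rfl⟩
    exact hf G (hS hG)
  · ext v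
    simp [zeros]

theorem comp_mem_polyFun {f : V → V'} (hf : ∀ l : Module.Dual k V', (l ∘ f) ∈ polyFun k V)
    {G : V' → k} (hG : G ∈ polyFun k V') : G ∘ f ∈ polyFun k V := by
  induction hG using Algebra.adjoin_induction with
  | mem G hG =>
    obtain ⟨l, rfl⟩ := hG
    exact hf l
  | algebraMap c => exact (polyFun k V).algebraMap_mem c
  | add G H _ _ hG hH => exact add_mem hG hH
  | mul G H _ _ hG hH => exact mul_mem hG hH

theorem dual_mem_polyFun (l : Module.Dual k V) : (l : V → k) ∈ polyFun k V :=
  Algebra.subset_adjoin ⟨l, rfl⟩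

end

variable {ι : Type*} [Fintype ι]

omit [Fintype ι] in
theorem coord_mem_polyFun (i : ι) : (fun v : ι → k => v i) ∈ polyFun k (ι → k) :=
  dual_mem_polyFun (LinearMap.proj (R := k) (φ := fun _ : ι => k) i)

theorem dual_pi_apply [DecidableEq ι] (l : Module.Dual k (ι → k)) (v : ι → k) :
    l v = ∑ i, v i * l (fun j => if j = i then 1 else 0) := by
  conv_lhs => rw [pi_eq_sum_univ v]
  simp [map_sum, eq_comm]

theorem mem_polyFun_iff {G : (ι → k) → k} :
    G ∈ polyFun k (ι → k) ↔ ∃ P : MvPolynomial ι k, ∀ v, MvPolynomial.eval v P = G v := by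
  classical
  constructor
  · intro hG
    induction hG using Algebra.adjoin_induction with
    | mem G hG =>
      obtain ⟨l, rfl⟩ := hG
      refine ⟨∑ i, MvPolynomial.X i * MvPolynomial.C (l (fun j => if j = i then 1 else 0)),
        fun v => ?_⟩
      change _ = l v
      rw [dual_pi_apply l v]
      simp
    | algebraMap c => exact ⟨MvPolynomial.C c, fun v => by simp⟩
    | add G H _ _ hG hH =>
      obtain ⟨P, hP⟩ := hG
      obtain ⟨Q, hQ⟩ := hH
      exact ⟨P + Q, fun v => by simp [hP, hQ]⟩
    | mul G H _ _ hG hH =>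
      obtain ⟨P, hP⟩ := hG
      obtain ⟨Q, hQ⟩ := hH
      exact ⟨P * Q, fun v => by simp [hP, hQ]⟩
  · rintro ⟨P, hP⟩
    obtain rfl : G = fun v => MvPolynomial.eval v P := funext fun v => (hP v).symm
    clear hP
    induction P using MvPolynomial.induction_on with
    | C c =>
      simp only [MvPolynomial.eval_C]
      exact (polyFun k (ι → k)).algebraMap_mem c
    | add P Q hP hQ =>
      simp only [map_add]
      exact add_mem hP hQ
    | mul_X P i hP =>
      simp only [map_mul, MvPolynomial.eval_X]
      exact mul_mem hP (coord_mem_polyFun i)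

theorem zariski_isIrreducible_univ [Infinite k] :
    @IsIrreducible (ι → k) (zariskiTopology k (ι → k)) Set.univ := by
  let _ := zariskiTopology k (ι → k)
  refine ⟨Set.univ_nonempty, ?_⟩
  rw [isPreirreducible_iff_isClosed_union_isClosed]
  intro Z₁ Z₂ h₁ h₂ h
  obtain ⟨S, hS, rfl⟩ := zariski_isClosed_iff.1 h₁
  obtain ⟨T, hT, rfl⟩ := zariski_isClosed_iff.1 h₂
  by_contra hc
  simp only [not_or, Set.not_subset, zeros, Set.mem_ofPred_eq, not_forall] at hc
  obtain ⟨⟨u, -, f, hf, hfu⟩, v, -, g, hg, hgv⟩ := hc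
  obtain ⟨P, hP⟩ := mem_polyFun_iff.1 (hS hf)
  obtain ⟨Q, hQ⟩ := mem_polyFun_iff.1 (hT hg)
  have hPQ : P * Q = 0 := by
    refine MvPolynomial.funext fun w => ?_
    have hw := h (Set.mem_univ w)
    have h1 := hP w
    have h2 := hQ w
    rw [map_mul, map_zero, h1, h2]
    rcases hw with hw | hw
    · rw [hw f hf, zero_mul]
    · rw [hw g hg, mul_zero]
  rcases mul_eq_zero.1 hPQ with rfl | rfl
  · exact hfu (by rw [← hP]; simp)
  · exact hgv (by rw [← hQ]; simp)

/-- The vanishing ideal of an irreducible set, as a point of the prime spectrum. -/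
def vanishingPrime (Z : Set (ι → k)) (hZ : @IsIrreducible (ι → k) (zariskiTopology k (ι → k)) Z) :
    PrimeSpectrum (MvPolynomial ι k) where
  asIdeal := MvPolynomial.vanishingIdeal k Z
  isPrime := by
    let _ := zariskiTopology k (ι → k)
    refine Ideal.isPrime_iff.2 ⟨?_, ?_⟩
    · rw [Ne, Ideal.eq_top_iff_one, MvPolynomial.mem_vanishingIdeal_iff]
      obtain ⟨v, hv⟩ := hZ.1
      exact fun h => one_ne_zero ((map_one (MvPolynomial.aeval (R := k) v)).symm.trans (h v hv))
    · intro P Q hPQ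
      simp only [MvPolynomial.mem_vanishingIdeal_iff, MvPolynomial.aeval_eq_eval] at hPQ ⊢
      have hcl (P : MvPolynomial ι k) : IsClosed (zeros {fun v : ι → k => MvPolynomial.eval v P}) :=
        zariski_isClosed_zeros (k := k) (by
          rw [Set.singleton_subset_iff]
          exact mem_polyFun_iff.2 ⟨P, fun _ => rfl⟩)
      have := isPreirreducible_iff_isClosed_union_isClosed.1 hZ.2 _ _ (hcl P) (hcl Q)
        (fun v hv => by simpa [zeros] using hPQ v hv)
      simpa [zeros, Set.subset_def] using this

theorem vanishingPrime_le_iff {Z Z' : Set (ι → k)}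
    (hZ : @IsIrreducible (ι → k) (zariskiTopology k (ι → k)) Z)
    (hZ' : @IsIrreducible (ι → k) (zariskiTopology k (ι → k)) Z')
    (hcl : @IsClosed (ι → k) (zariskiTopology k (ι → k)) Z) :
    vanishingPrime Z hZ ≤ vanishingPrime Z' hZ' ↔ Z' ⊆ Z := by
  constructor
  · intro h v hv
    obtain ⟨S, hS, hZS⟩ := zariski_isClosed_iff.1 hcl
    rw [hZS]
    intro f hf
    obtain ⟨P, hP⟩ := mem_polyFun_iff.1 (hS hf)
    have h1 : P ∈ (vanishingPrime Z hZ).asIdeal :=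
      MvPolynomial.mem_vanishingIdeal_iff.2 fun u hu => by
        rw [hZS] at hu
        exact (hP u).trans (hu f hf)
    rw [← hP]
    exact MvPolynomial.mem_vanishingIdeal_iff.1 (h h1) v hv
  · exact fun h => MvPolynomial.vanishingIdeal_anti_mono h

/-- Vanishing ideals embed the irreducible closed sets, with order reversed, into the spectrum of a
polynomial ring. The bound needs only this strict monotonicity, not the Nullstellensatz. -/
theorem topologicalKrullDim_pi_le :
    @topologicalKrullDim (ι → k) (zariskiTopology k (ι → k)) ≤ Fintype.card ι := by
  let _ := zariskiTopology k (ι → k)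
  have h1 : topologicalKrullDim (ι → k) ≤ Order.krullDim (PrimeSpectrum (MvPolynomial ι k))ᵒᵈ := by
    refine Order.krullDim_le_of_strictMono
      (fun Z => OrderDual.toDual (vanishingPrime Z.1 Z.2)) fun Z Z' h => ?_
    rw [OrderDual.toDual_lt_toDual, lt_iff_le_not_ge, vanishingPrime_le_iff _ _ Z'.3,
      vanishingPrime_le_iff _ _ Z.3]
    exact lt_iff_le_not_ge.1 h
  rw [Order.krullDim_orderDual] at h1
  refine h1.trans (le_of_eq ?_)
  change ringKrullDim (MvPolynomial ι k) = _
  rw [MvPolynomial.ringKrullDim_of_isNoetherianRing, ringKrullDim_eq_zero_of_field, zero_add,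
    Nat.card_eq_fintype_card]

/-- A flat is the continuous image of the irreducible affine space under the map that freezes the
coordinates in `s`. -/
theorem isIrreducible_flat [Infinite k] (q : ι → k) (s : Set ι) :
    @IsIrreducible (ι → k) (zariskiTopology k (ι → k)) {v | ∀ i ∈ s, v i = q i} := by
  classical
  let _ := zariskiTopology k (ι → k)
  let f : (ι → k) → (ι → k) := fun v i => if i ∈ s then q i else v i
  have hf : Continuous f := zariski_continuous (k := k) fun G hG => comp_mem_polyFun (fun l => by
    have : l ∘ f = ∑ i, (fun v : ι → k => if i ∈ s then q i else v i) *
        algebraMap k ((ι → k) → k) (l (fun j => if j = i then 1 else 0)) := by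
      ext v
      simp [dual_pi_apply l (f v), f]
    rw [this]
    refine sum_mem fun i _ => mul_mem ?_ (Subalgebra.algebraMap_mem _ _)
    split_ifs
    · exact (polyFun k (ι → k)).algebraMap_mem (q i)
    · exact coord_mem_polyFun i) hG
  have := (zariski_isIrreducible_univ (k := k) (ι := ι)).image f hf.continuousOn
  convert this using 1
  ext v
  constructor
  · exact fun h => ⟨v, trivial, funext fun i => by
      by_cases hi : i ∈ s
      · simp [f, hi, h i hi]
      · simp [f, hi]⟩
  · rintro ⟨u, -, rfl⟩ i hi
    simp [f, hi]

omit [Fintype ι] in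
theorem isClosed_flat (q : ι → k) (s : Set ι) :
    @IsClosed (ι → k) (zariskiTopology k (ι → k)) {v | ∀ i ∈ s, v i = q i} := by
  refine zariski_isClosed_iff.2 ⟨(fun i v => v i - q i) '' s, ?_, ?_⟩
  · rintro _ ⟨i, -, rfl⟩
    exact sub_mem (coord_mem_polyFun i) ((polyFun k (ι → k)).algebraMap_mem (q i))
  · ext v
    simp [zeros, sub_eq_zero]

/-- A nonempty open subset of affine space has full dimension. -/
theorem zariskiDim_of_isOpen [Infinite k] {U : Set (ι → k)}
    (hU : @IsOpen (ι → k) (zariskiTopology k (ι → k)) U) (hne : U.Nonempty) :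
    zariskiDim k U = Fintype.card ι := by
  classical
  let _ := zariskiTopology k (ι → k)
  refine le_antisymm ?_ ?_
  · exact (topologicalKrullDim_subspace_le (ι → k) U).trans topologicalKrullDim_pi_le
  · obtain ⟨q, hq⟩ := hne
    let n := Fintype.card ι
    let e : ι ≃ Fin n := Fintype.equivFin ι
    have hemb : Topology.IsOpenEmbedding (Subtype.val : U → (ι → k)) := hU.isOpenEmbedding_subtypeVal
    -- A full flag of flats through a point `q` of `U`, from the point itself at `j = 0` to the
    -- whole space at `j = n`. All of them meet `U`, so they give a chain of irreducible closed
    -- subsets of `U`.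
    let L : ℕ → Set (ι → k) := fun j => {v | ∀ i ∈ {i | j ≤ (e i : ℕ)}, v i = q i}
    let F : Fin (n + 1) → {Z : TopologicalSpace.IrreducibleCloseds (ι → k) |
        ((Subtype.val : U → (ι → k)) ⁻¹' Z).Nonempty} := fun j =>
      ⟨⟨L j, isIrreducible_flat q _, isClosed_flat q _⟩, ⟨⟨q, hq⟩, fun i _ => rfl⟩⟩
    have hF : StrictMono F := by
      intro a b hab
      have hab' : (a : ℕ) < b := hab
      rw [lt_iff_le_not_ge]
      constructor
      · change L a ⊆ L b
        exact fun v hv i (hi : (b : ℕ) ≤ e i) => hv i (hab'.le.trans hi)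
      · change ¬ L b ⊆ L a
        intro h
        let i₀ := e.symm ⟨a, by omega⟩
        have hi₀ : (e i₀ : ℕ) = a := by simp [i₀]
        have h1 : Function.update q i₀ (q i₀ + 1) ∈ L b := fun i (hi : (b : ℕ) ≤ e i) => by
          rw [Function.update_of_ne]
          rintro rfl
          omega
        have h2 := h h1 i₀ hi₀.ge
        simp at h2
    have h1 := Order.LTSeries.length_le_krullDim (LTSeries.mk n F hF)
    rw [← Order.krullDim_eq_of_orderIso
      (TopologicalSpace.IrreducibleCloseds.orderIsoOfIsOpenEmbedding _ hemb)] at h1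
    exact h1

/-! ### Dimension of a set parametrized by regular functions. -/

variable {V : Type*} [AddCommGroup V] [Module k V]

/-- The functions on `S` which become polynomials in the coordinates `π` after multiplication by
a power of `c`. -/
def regularFunctions (π : V →ₗ[k] (ι → k)) (c : (ι → k) → k) (S : Set V)
    (hc : c ∈ polyFun k (ι → k)) : Subalgebra k (S → k) where
  carrier := {φ | ∃ M : ℕ, ∃ G ∈ polyFun k (ι → k), ∀ s : S, c (π s) ^ M * φ s = G (π s)}
  algebraMap_mem' a := ⟨0, algebraMap k _ a, Subalgebra.algebraMap_mem _ a, fun s => by simp⟩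
  mul_mem' := by
    rintro φ ψ ⟨M, G, hG, h⟩ ⟨N, H, hH, h'⟩
    refine ⟨M + N, G * H, mul_mem hG hH, fun s => ?_⟩
    rw [Pi.mul_apply, Pi.mul_apply, ← h, ← h', pow_add]
    ring
  add_mem' := by
    rintro φ ψ ⟨M, G, hG, h⟩ ⟨N, H, hH, h'⟩
    refine ⟨M + N, c ^ N * G + c ^ M * H,
      add_mem (mul_mem (pow_mem hc _) hG) (mul_mem (pow_mem hc _) hH), fun s => ?_⟩
    rw [Pi.add_apply, Pi.add_apply, Pi.mul_apply, Pi.mul_apply, ← h, ← h', pow_add, Pi.pow_apply,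
      Pi.pow_apply]
    ring

/-- A subset of `V` on which all linear forms are regular functions of the coordinates `π`, and
whose image under `π` is a principal open set of affine space, has the dimension of that space. -/
theorem zariskiDim_eq_of_regular [Infinite k] (π : V →ₗ[k] (ι → k)) {c : (ι → k) → k} {S : Set V}
    (hc : c ∈ polyFun k (ι → k)) (hS : π '' S = {v | c v ≠ 0}) (hne : {v | c v ≠ 0}.Nonempty)
    (hreg : ∀ l : Module.Dual k V, (fun s : S => l s) ∈ regularFunctions π c S hc) :
    zariskiDim k S = Fintype.card ι := by
  let _ := zariskiTopology k V
  let _ := zariskiTopology k (ι → k)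
  have hcS (s : S) : c (π s) ≠ 0 := by
    have : π s ∈ π '' S := ⟨s, s.2, rfl⟩
    rwa [hS] at this
  have hpoly {F : V → k} (hF : F ∈ polyFun k V) :
      (fun s : S => F s) ∈ regularFunctions π c S hc := by
    induction hF using Algebra.adjoin_induction with
    | mem F hF =>
      obtain ⟨l, rfl⟩ := hF
      exact hreg l
    | algebraMap a => exact (regularFunctions π c S hc).algebraMap_mem a
    | add F G _ _ hF hG => exact add_mem hF hG
    | mul F G _ _ hF hG => exact mul_mem hF hG
  have hcont : Continuous π := zariski_continuous (k := k) fun G hG =>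
    comp_mem_polyFun (fun l => dual_mem_polyFun (l ∘ₗ π)) hG
  let g : S → π '' S := fun s => ⟨π s, s, s.2, rfl⟩
  have hg : Continuous g := (hcont.comp continuous_subtype_val).subtype_mk _
  -- Linear forms separate the points of `V`, and on `S` each of them is determined by the
  -- coordinates `π`.
  have hinj : Function.Injective g := by
    intro s s' h
    have hπ : π s = π s' := congrArg Subtype.val h
    refine Subtype.ext (sub_eq_zero.1 ((Module.forall_dual_apply_eq_zero_iff k _).1 fun l => ?_))
    obtain ⟨M, G, -, hG⟩ := hreg l
    rw [map_sub, sub_eq_zero]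
    refine mul_left_cancel₀ (pow_ne_zero M (hcS s)) ?_
    rw [hG s, hπ, ← hG s']
  have hsurj : Function.Surjective g := by
    rintro ⟨_, s, hs, rfl⟩
    exact ⟨⟨s, hs⟩, rfl⟩
  -- Multiplying by a power of `c`, which has no zero on the image, turns a polynomial equation on
  -- `S` into one in the coordinates.
  have hclosed : IsClosedMap g := by
    intro Z hZ
    obtain ⟨Z', hZ', rfl⟩ := isClosed_induced_iff.1 hZ
    obtain ⟨T, hT, rfl⟩ := zariski_isClosed_iff.1 hZ'
    refine isClosed_induced_iff.2 ⟨zeros {G | G ∈ polyFun k (ι → k) ∧ ∃ F ∈ T, ∃ M : ℕ,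
      ∀ s : S, c (π s) ^ M * F s = G (π s)}, zariski_isClosed_zeros fun G hG => hG.1, ?_⟩
    ext ⟨_, s, hs, rfl⟩
    constructor
    · intro h
      refine ⟨⟨s, hs⟩, fun F hF => ?_, rfl⟩
      obtain ⟨M, G, hG, hFG⟩ := hpoly (hT hF)
      have h1 : G (π s) = 0 := h G ⟨hG, F, hF, M, hFG⟩
      exact (mul_eq_zero.1 ((hFG ⟨s, hs⟩).trans h1)).resolve_left (pow_ne_zero M (hcS ⟨s, hs⟩))
    · rintro ⟨s', hs', h⟩ G ⟨-, F, hF, M, hFG⟩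
      have h1 : π s' = π s := congrArg Subtype.val h
      change G (π s) = 0
      rw [← h1, ← hFG, hs' F hF, mul_zero]
  have hhom : IsHomeomorph g :=
    isHomeomorph_iff_continuous_isClosedMap_bijective.2 ⟨hg, hclosed, hinj, hsurj⟩
  have h1 : zariskiDim k S = zariskiDim k (π '' S) := hhom.topologicalKrullDim_eq g
  rw [h1, hS]
  exact zariskiDim_of_isOpen (zariski_isOpen_ne hc) hne

end Zariski

end

/-! ### Dimensions of the sets given by order, leading term or residue. -/

section

variable {k : Type*} [Field k] {p : ℕ}

section

variable [CharP k p]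

/-- The coefficients with index in `J`, as coordinates on `W`. -/
def coordProj (J : Finset ℕ) : W k p →ₗ[k] (J → k) :=
  LinearMap.pi fun i => coeffA (i : ℕ) ∘ₗ valueAtX.toLinearMap

theorem coordProj_apply (J : Finset ℕ) (w : W k p) (i : J) :
    coordProj J w i = coeffA (i : ℕ) (w (x k p)) := rfl

/-- Linear forms on `W` are combinations of the coefficients, so regularity need only be checked for
these. -/
theorem dual_mem_of_coeffA_mem {S : Set (W k p)} {B : Subalgebra k (S → k)}
    (h : ∀ m < p, (fun s : S => coeffA m ((s : W k p) (x k p))) ∈ B) (l : Module.Dual k (W k p)) :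
    (fun s : S => l s) ∈ B := by
  have h1 : (fun s : S => l s) = ∑ m ∈ Finset.range p,
      (fun s : S => coeffA m ((s : W k p) (x k p))) *
        algebraMap k (S → k) (l (valueAtX.symm (x k p ^ m))) := by
    ext s
    have : (s : W k p) = valueAtX.symm ((s : W k p) (x k p)) :=
      (valueAtX.symm_apply_apply (s : W k p)).symm
    conv_lhs => rw [this, eq_sum_coeffA ((s : W k p) (x k p))]
    simp [map_sum]
  rw [h1]
  exact sum_mem fun m hm => mul_mem (h m (Finset.mem_range.1 hm)) (Subalgebra.algebraMap_mem _ _)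

theorem coeffA_mem_regularFunctions {J : Finset ℕ} {S : Set (W k p)} {c : (J → k) → k}
    (hc : c ∈ polyFun k (J → k)) {m : ℕ} (hm : m ∈ J) :
    (fun s : S => coeffA m ((s : W k p) (x k p))) ∈ regularFunctions (coordProj J) c S hc :=
  ⟨0, _, coord_mem_polyFun ⟨m, hm⟩, fun s => by rw [pow_zero, one_mul, coordProj_apply]⟩

theorem exists_coordProj_eq {J : Finset ℕ} (hJ : ∀ m ∈ J, m < p) (v : J → k) :
    ∃ w : W k p, coordProj J w = v ∧ ∀ m < p, m ∉ J → coeffA m (w (x k p)) = 0 := by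
  classical
  obtain ⟨a, ha⟩ := exists_coeffA_eq (p := p) fun m => if h : m ∈ J then v ⟨m, h⟩ else 0
  refine ⟨a • partialD k p, ?_, fun m hm hmJ => ?_⟩
  · ext i
    rw [coordProj_apply, smul_partialD_x, ha _ (hJ i i.2), dif_pos i.2]
  · rw [smul_partialD_x, ha m hm, dif_neg hmJ]

end

variable [Fact p.Prime]

/-- The coefficients of an inverse satisfy a recursion whose only denominator is the constant term.
-/
theorem coeffA_inv_mem {T : Type*} (B : Subalgebra k (T → k)) {h hi : T → A k p}
    (hh : ∀ t, h t * hi t = 1) {Q : ℕ} (hQ : Q < p)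
    (hmem : ∀ q ≤ Q, (fun t => coeffA q (h t)) ∈ B)
    (h0 : (fun t => (coeffA 0 (h t))⁻¹) ∈ B) : ∀ q ≤ Q, (fun t => coeffA q (hi t)) ∈ B := by
  have hne (t : T) : coeffA 0 (h t) ≠ 0 :=
    (isUnit_iff_coeffA _).1 (IsUnit.of_mul_eq_one _ (hh t))
  intro q
  induction q using Nat.strong_induction_on with
  | _ q ih =>
    intro hq
    rcases Nat.eq_zero_or_pos q with rfl | hq0
    · convert h0 using 2 with t
      have := coeffA_zero_mul (h t) (hi t)
      rw [hh, coeffA_zero_one] at this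
      exact eq_inv_of_mul_eq_one_right this.symm
    · have h1 : (fun t => coeffA q (hi t)) = -((fun t => (coeffA 0 (h t))⁻¹) *
          ∑ i ∈ Finset.range q, (fun t => coeffA (i + 1) (h t)) *
            (fun t => coeffA (q - (i + 1)) (hi t))) := by
        ext t
        have h2 := coeffA_mul (hq.trans_lt hQ) (h t) (hi t)
        rw [hh, coeffA_one (hq.trans_lt hQ), if_neg hq0.ne',
          Finset.Nat.sum_antidiagonal_eq_sum_range_succ (fun i j => coeffA i (h t) * coeffA j (hi t)),
          Finset.sum_range_succ'] at h2
        simp only [Nat.sub_zero] at h2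
        simp only [Pi.neg_apply, Pi.mul_apply, Finset.sum_apply]
        have := hne t
        field_simp
        linear_combination -h2
      rw [h1]
      refine neg_mem (mul_mem h0 (sum_mem fun i hi' => mul_mem (hmem _ ?_) (ih _ ?_ ?_))) <;>
        have := Finset.mem_range.1 hi' <;> omega

variable [CharP k p] [Infinite k]

omit [Fact p.Prime] in
theorem zariskiDim_order {n : ℕ} (hn : n < p) :
    zariskiDim k {w : W k p | x k p ^ n ∣ w (x k p) ∧ coeffA n (w (x k p)) ≠ 0} =
      ((p - n : ℕ) : WithBot ℕ∞) := by
  have hJ : ∀ m ∈ Finset.Ico n p, m < p := fun m hm => (Finset.mem_Ico.1 hm).2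
  have hnJ : n ∈ Finset.Ico n p := Finset.mem_Ico.2 ⟨le_rfl, hn⟩
  have himage : (coordProj (Finset.Ico n p)) ''
      {w : W k p | x k p ^ n ∣ w (x k p) ∧ coeffA n (w (x k p)) ≠ 0} =
        {v | (fun v : Finset.Ico n p → k => v ⟨n, hnJ⟩) v ≠ 0} := by
    ext v
    constructor
    · rintro ⟨w, ⟨-, h⟩, rfl⟩
      exact h
    · intro hv
      obtain ⟨w, rfl, h⟩ := exists_coordProj_eq hJ v
      refine ⟨w, ⟨(x_pow_dvd_iff hn.le _).2 fun m hm => h m (by omega) ?_, hv⟩, rfl⟩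
      rw [Finset.mem_Ico]
      omega
  have hdim := zariskiDim_eq_of_regular (k := k) (V := W k p) (coordProj (Finset.Ico n p)) (coord_mem_polyFun _) himage
    ⟨fun _ => 1, one_ne_zero⟩
    (fun l => dual_mem_of_coeffA_mem (fun m hm => ?_) l)
  · rw [hdim, Fintype.card_coe, Nat.card_Ico]
  · by_cases hmn : n ≤ m
    · exact coeffA_mem_regularFunctions _ (Finset.mem_Ico.2 ⟨hmn, hm⟩)
    · convert Subalgebra.zero_mem _ with s
      exact (x_pow_dvd_iff hn.le _).1 s.2.1 m (by omega)

omit [Fact p.Prime] in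
theorem zariskiDim_leading_term (hp : 2 ≤ p) (a : k) :
    zariskiDim k {w : W k p | coeffA 0 (w (x k p)) = 0 ∧ coeffA 1 (w (x k p)) = a} =
      ((p - 2 : ℕ) : WithBot ℕ∞) := by
  have hJ : ∀ m ∈ Finset.Ico 2 p, m < p := fun m hm => (Finset.mem_Ico.1 hm).2
  have himage : (coordProj (Finset.Ico 2 p)) ''
      {w : W k p | coeffA 0 (w (x k p)) = 0 ∧ coeffA 1 (w (x k p)) = a} =
        {v | (1 : (Finset.Ico 2 p → k) → k) v ≠ 0} := by
    ext v
    refine ⟨fun _ => one_ne_zero, fun _ => ?_⟩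
    obtain ⟨w, rfl, h⟩ := exists_coordProj_eq hJ v
    have hx (m : ℕ) (hm : m < p) : coeffA m ((w + (a • x k p ^ 1) • partialD k p) (x k p)) =
        coeffA m (w (x k p)) + if m = 1 then a else 0 := by
      rw [Derivation.add_apply, smul_partialD_x, map_add, map_smul, coeffA_x_pow hm]
      simp
    refine ⟨w + (a • x k p ^ 1) • partialD k p, ⟨?_, ?_⟩, ?_⟩
    · rw [hx 0 (by omega), h 0 (by omega) (by simp)]
      simp
    · rw [hx 1 (by omega), h 1 (by omega) (by simp)]
      simp
    · ext i
      have := Finset.mem_Ico.1 i.2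
      rw [coordProj_apply, hx _ (hJ i i.2), if_neg (by omega), add_zero]
      rfl
  have hdim := zariskiDim_eq_of_regular (k := k) (V := W k p) (coordProj (Finset.Ico 2 p)) (one_mem _) himage
    ⟨fun _ => 1, one_ne_zero⟩
    (fun l => dual_mem_of_coeffA_mem (fun m hm => ?_) l)
  · rw [hdim, Fintype.card_coe, Nat.card_Ico]
  · rcases Nat.lt_or_ge m 2 with h | h
    · convert Subalgebra.algebraMap_mem _ (if m = 0 then (0 : k) else a) with s
      interval_cases m
      · exact s.2.1
      · exact s.2.2
    · exact coeffA_mem_regularFunctions _ (Finset.mem_Ico.2 ⟨h, hm⟩)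

omit [CharP k p] [Infinite k] in
/-- Changing the coefficient of degree `m` of a unit changes that of its inverse linearly. -/
theorem coeffA_inv_add_smul {h h₀ hi hi₀ : A k p} {t : k} {m : ℕ} (hm : m < p) (hm0 : 1 ≤ m)
    (he : h = h₀ + t • x k p ^ m) (hh : h * hi = 1) (hh₀ : h₀ * hi₀ = 1) :
    coeffA 0 h ^ 2 * (coeffA m hi₀ - coeffA m hi) = t := by
  have h1 : hi₀ - hi = t • (x k p ^ m * (hi * hi₀)) := by
    rw [← smul_mul_assoc, ← sub_eq_iff_eq_add'.2 he]
    linear_combination (-hi₀) * hh + hi * hh₀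
  have h00 : coeffA 0 h = coeffA 0 h₀ := by
    rw [he, map_add, map_smul, coeffA_x_pow prime_pos', if_neg (by omega), smul_zero, add_zero]
  have h2 := congrArg (coeffA 0) hh
  have h3 := congrArg (coeffA 0) hh₀
  rw [coeffA_zero_mul, coeffA_zero_one] at h2 h3
  rw [← map_sub, h1, map_smul, coeffA_x_pow_mul hm, if_pos le_rfl, Nat.sub_self, coeffA_zero_mul,
    smul_eq_mul]
  rw [← h00] at h3
  linear_combination t * (coeffA 0 h * coeffA 0 hi₀) * h2 + t * h3

/-- The elements `x^n h ∂` with prescribed coefficient of degree `N - 1` of `h⁻¹` (up to a power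
of the leading coefficient) form a hypersurface in the space of elements of order `n`. -/
theorem zariskiDim_residue {n N E : ℕ} (hN : 2 ≤ N) (hnN : n + N ≤ p) (a : k) :
    zariskiDim k {w : W k p | ∃ h hi, w (x k p) = x k p ^ n * h ∧ h * hi = 1 ∧
      coeffA (N - 1) hi = -a * coeffA 0 hi ^ E} = ((p - n - 1 : ℕ) : WithBot ℕ∞) := by
  classical
  set S := {w : W k p | ∃ h hi, w (x k p) = x k p ^ n * h ∧ h * hi = 1 ∧
    coeffA (N - 1) hi = -a * coeffA 0 hi ^ E} with hS
  -- Coefficient `N - 1` of `h` is coefficient `r` of `w`. The residue condition is linear in it, so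
  -- it is dropped from the coordinates and recovered from the others.
  set r := n + N - 1 with hr
  set J := (Finset.Ico n p).erase r with hJdef
  have hmemJ (m : ℕ) : m ∈ J ↔ m ≠ r ∧ n ≤ m ∧ m < p := by
    rw [hJdef, Finset.mem_erase, Finset.mem_Ico]
  have hJ : ∀ m ∈ J, m < p := fun m hm => ((hmemJ m).1 hm).2.2
  have hnJ : n ∈ J := (hmemJ n).2 ⟨by omega, le_rfl, by omega⟩
  have hcoeff {w : W k p} {h : A k p} (e : w (x k p) = x k p ^ n * h) (q : ℕ) (hq : n + q < p) :
      coeffA (n + q) (w (x k p)) = coeffA q h := by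
    rw [e, coeffA_x_pow_mul hq, if_pos (by omega), Nat.add_sub_cancel_left]
  have himage : coordProj J '' S = {v : J → k | v ⟨n, hnJ⟩ ≠ 0} := by
    ext v
    constructor
    · rintro ⟨w, ⟨h, hi, e, hh, -⟩, rfl⟩
      change coeffA (n + 0) (w (x k p)) ≠ 0
      rw [hcoeff e 0 (by omega)]
      exact (isUnit_iff_coeffA h).1 (IsUnit.of_mul_eq_one _ hh)
    · intro hv
      obtain ⟨w, rfl, hw⟩ := exists_coordProj_eq hJ v
      obtain ⟨h₀, e, hc, hu⟩ := exists_eq_x_pow_mul (m := n) (by omega)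
        (fun m hm => hw m (by omega) (by rw [hmemJ]; omega)) hv
      obtain ⟨hi₀, hh₀⟩ := hu.exists_right_inv
      have h00 (t : k) : coeffA 0 (h₀ + t • x k p ^ (N - 1)) = coeffA 0 h₀ := by
        rw [map_add, map_smul, coeffA_x_pow prime_pos', if_neg (by omega), smul_zero, add_zero]
      have hne : coeffA 0 h₀ ≠ 0 := (isUnit_iff_coeffA h₀).1 hu
      -- Adding `t x^(N-1)` to `h₀` lowers coefficient `N - 1` of the inverse by `t / h₀(0)²` and
      -- leaves the constant term unchanged; this `t` yields the prescribed value.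
      obtain ⟨t, ht⟩ : ∃ t : k, t = coeffA 0 h₀ ^ 2 *
        (coeffA (N - 1) hi₀ + a * (coeffA 0 h₀)⁻¹ ^ E) := ⟨_, rfl⟩
      have hunit : IsUnit (h₀ + t • x k p ^ (N - 1)) := by
        rwa [isUnit_iff_coeffA, h00]
      obtain ⟨hi, hh⟩ := hunit.exists_right_inv
      have h1 := coeffA_inv_add_smul (by omega) (by omega) rfl hh hh₀
      have h2 : coeffA 0 hi = (coeffA 0 h₀)⁻¹ := by
        have := congrArg (coeffA 0) hh
        rw [coeffA_zero_mul, h00, coeffA_zero_one] at this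
        exact eq_inv_of_mul_eq_one_right this
      refine ⟨(x k p ^ n * (h₀ + t • x k p ^ (N - 1))) • partialD k p,
        ⟨_, hi, smul_partialD_x _, hh, ?_⟩, ?_⟩
      · rw [h00, ht] at h1
        have h3 := mul_left_cancel₀ (pow_ne_zero 2 hne) h1
        rw [h2]
        linear_combination -h3
      · ext i
        have hi' := (hmemJ i).1 i.2
        rw [coordProj_apply, coordProj_apply, smul_partialD_x, mul_add, ← e, mul_smul_comm,
          ← pow_add, map_add, map_smul, coeffA_x_pow hi'.2.2, if_neg (by omega), smul_zero,
          add_zero]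
  have hdim := zariskiDim_eq_of_regular (k := k) (V := W k p) (coordProj J) (coord_mem_polyFun _) himage
    ⟨fun _ => 1, one_ne_zero⟩
    (fun l => dual_mem_of_coeffA_mem (fun m hm => ?_) l)
  · rw [hdim, Fintype.card_coe, hJdef, Finset.card_erase_of_mem, Nat.card_Ico]
    rw [Finset.mem_Ico]
    omega
  · set B := regularFunctions (coordProj J) (fun v => v ⟨n, hnJ⟩) S (coord_mem_polyFun _)
    by_cases hmJ : m ∈ J
    · exact coeffA_mem_regularFunctions _ hmJ
    choose h hi hs hh hinv using fun s : S => s.2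
    by_cases hmr : m = r
    · have hne (s : S) : coeffA 0 (h s) ≠ 0 :=
        (isUnit_iff_coeffA _).1 (IsUnit.of_mul_eq_one _ (hh s))
      have hcJ (q : ℕ) (hq : n + q ∈ J) : (fun s : S => coeffA q (h s)) ∈ B := by
        convert coeffA_mem_regularFunctions (S := S) (coord_mem_polyFun ⟨n, hnJ⟩) hq using 2 with s
        exact (hcoeff (hs s) q (hJ _ hq)).symm
      have hcinv : (fun s : S => (coeffA 0 (h s))⁻¹) ∈ B := by
        refine ⟨1, 1, one_mem _, fun s => ?_⟩
        rw [pow_one]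
        change coeffA (n + 0) ((s : W k p) (x k p)) * (coeffA 0 (h s))⁻¹ = (1 : k)
        rw [hcoeff (hs s) 0 (by omega), mul_inv_cancel₀ (hne s)]
      -- Deleting this coefficient from `h` leaves a unit whose coefficients up to `N - 1` depend on
      -- the coordinates in `J` alone. Its inverse is therefore regular, and `t` is expressed
      -- through that inverse in `hfun`.
      set t : S → k := fun s => coeffA (N - 1) (h s)
      have hcoeff₀ (s : S) (q : ℕ) (hq : q < p) : coeffA q (h s - t s • x k p ^ (N - 1)) =
          if q = N - 1 then 0 else coeffA q (h s) := by
        rw [map_sub, map_smul, coeffA_x_pow hq]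
        split_ifs with e
        · simp [t, e]
        · simp
      have hex (s : S) : ∃ b, (h s - t s • x k p ^ (N - 1)) * b = 1 := by
        refine IsUnit.exists_right_inv ((isUnit_iff_coeffA _).2 ?_)
        rw [hcoeff₀ s 0 (by omega), if_neg (by omega)]
        exact hne s
      choose hi₀ hh₀ using hex
      have hreg₀ := coeffA_inv_mem B hh₀ (Q := N - 1) (by omega) (fun q hq => by
          simp only [hcoeff₀ _ q (by omega)]
          split_ifs with e
          · exact zero_mem B
          · exact hcJ q ((hmemJ _).2 ⟨by omega, by omega, by omega⟩))
        (by
          simp only [hcoeff₀ _ 0 (by omega : 0 < p), if_neg (by omega : 0 ≠ N - 1)]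
          exact hcinv) (N - 1) le_rfl
      have hfun : (fun s : S => coeffA m ((s : W k p) (x k p))) =
          (fun s : S => coeffA 0 (h s)) ^ 2 * ((fun s : S => coeffA (N - 1) (hi₀ s)) +
            algebraMap k (S → k) a * (fun s : S => (coeffA 0 (h s))⁻¹) ^ E) := by
        ext s
        have h1 := coeffA_inv_add_smul (by omega) (by omega)
          (sub_add_cancel (h s) (t s • x k p ^ (N - 1))).symm (hh s) (hh₀ s)
        have h2 : coeffA 0 (hi s) = (coeffA 0 (h s))⁻¹ := by
          have := congrArg (coeffA 0) (hh s)
          rw [coeffA_zero_mul, coeffA_zero_one] at this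
          exact eq_inv_of_mul_eq_one_right this
        have h3 : coeffA m ((s : W k p) (x k p)) = t s := by
          rw [hmr, hr, Nat.add_sub_assoc (by omega), hcoeff (hs s) _ (by omega)]
        rw [h3, ← h1, hinv s, h2]
        simp
      rw [hfun]
      exact mul_mem (pow_mem (hcJ 0 hnJ) 2)
        (add_mem hreg₀ (mul_mem (Subalgebra.algebraMap_mem _ _) (pow_mem hcinv E)))
    · convert B.zero_mem with s
      rw [hs s, coeffA_x_pow_mul hm, if_neg]
      · rfl
      · rw [hmemJ] at hmJ
        omega

end

/-! ### Degrees, representatives and dimensions of the orbits. -/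

section

variable {k : Type*} [Field k] {p : ℕ} [CharP k p]

theorem e_eq {i : ℤ} (n : ℕ) (h : i = (n : ℤ) - 1) : e k p i = x k p ^ n • partialD k p :=
  derivation_ext_x (by rw [h, e_apply_x, smul_partialD_x])

theorem e_add_smul_e {i j : ℤ} (n m : ℕ) (hn : i = (n : ℤ) - 1) (hm : j = (m : ℤ) - 1) (a : k) :
    e k p i + a • e k p j = (x k p ^ n + a • x k p ^ m) • partialD k p := by
  rw [e_eq n hn, e_eq m hm, add_smul, smul_assoc]

theorem HasDegree.exists_eq {w : W k p} {i : ℤ} (h : HasDegree w i) :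
    ∃ n : ℕ, n < p ∧ i = (n : ℤ) - 1 := by
  by_contra hc
  have hi : ¬ (-1 ≤ i ∧ i ≤ (p : ℤ) - 2) := fun hi => hc ⟨(i + 1).toNat, by omega, by omega⟩
  refine h.2 ?_
  -- Outside the range `-1, …, p - 2` no basis vector separates consecutive steps of the filtration.
  have : filtration k p i = filtration k p (i + 1) := by
    rw [filtration, filtration]
    congr 2
    ext j
    simp only [Set.mem_ofPred_eq]
    omega
  rw [← this]
  exact h.1

variable [Fact p.Prime]

theorem existsUnique_hasDegree {w : W k p} (hw : w ≠ 0) : ∃! i : ℤ, HasDegree w i := by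
  have hw' : ∃ n, n < p ∧ coeffA n (w (x k p)) ≠ 0 := by
    by_contra hc
    push Not at hc
    exact hw (derivation_ext_x (eq_zero_of_coeffA hc))
  classical
  obtain ⟨hn, hn'⟩ := Nat.find_spec hw'
  have hmin (m : ℕ) (hm : m < Nat.find hw') : coeffA m (w (x k p)) = 0 := by
    have := Nat.find_min hw' hm
    push Not at this
    exact this (by omega)
  refine ⟨((Nat.find hw' : ℕ) : ℤ) - 1,
    (hasDegree_iff hn w).2 ⟨(x_pow_dvd_iff hn.le _).2 hmin, hn'⟩, fun i hi => ?_⟩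
  obtain ⟨m, hm, rfl⟩ := hi.exists_eq
  obtain ⟨h1, h2⟩ := (hasDegree_iff hm w).1 hi
  rw [x_pow_dvd_iff hm.le] at h1
  rcases lt_trichotomy m (Nat.find hw') with h | h | h
  · exact absurd (hmin m h) h2
  · rw [h]
  · exact absurd (h1 _ h) hn'

theorem HasDegree.map (hp : 3 < p) (σ : W k p ≃ₗ⁅k⁆ W k p) {w : W k p} {i : ℤ}
    (h : HasDegree w i) : HasDegree (σ w) i := by
  obtain ⟨n, hn, rfl⟩ := h.exists_eq
  rw [hasDegree_iff hn] at h ⊢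
  exact order_of_mem_orbit hp ⟨σ, rfl⟩ hn h.1 h.2

/-- A common frame for the four cases: a family with parameters satisfying `P`, where existence and
uniqueness are stated for the parameter. -/
theorem isSetOfRepresentatives_of_family {α : Type*} {P : α → Prop} {r : α → W k p} {n : ℕ}
    (hn : n < p) {i : ℤ} (hi : i = (n : ℤ) - 1) {R : Set (W k p)}
    (hR : ∀ w, w ∈ R ↔ ∃ a, P a ∧ w = r a)
    (hdeg : ∀ a, P a → x k p ^ n ∣ r a (x k p) ∧ coeffA n (r a (x k p)) ≠ 0)
    (hex : ∀ w : W k p, x k p ^ n ∣ w (x k p) → coeffA n (w (x k p)) ≠ 0 →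
      ∃ a, P a ∧ w ∈ orbit (r a))
    (huniq : ∀ a b w, P a → P b → w ∈ orbit (r a) → w ∈ orbit (r b) → a = b) :
    IsSetOfRepresentatives R i := by
  subst hi
  constructor
  · intro w hw
    obtain ⟨a, ha, rfl⟩ := (hR w).1 hw
    exact (hasDegree_iff hn _).2 (hdeg a ha)
  · intro w hw
    obtain ⟨h1, h2⟩ := (hasDegree_iff hn w).1 hw
    obtain ⟨a, ha, hwa⟩ := hex w h1 h2
    refine ⟨r a, ⟨(hR _).2 ⟨a, ha, rfl⟩, hwa⟩, ?_⟩
    rintro v ⟨hv, hwv⟩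
    obtain ⟨b, hb, rfl⟩ := (hR v).1 hv
    rw [huniq b a w hb ha hwv hwa]

theorem eq_of_mem_orbit_degree_neg_one (hp : 3 < p) {a b : k} {w : W k p}
    (ha : w ∈ orbit ((1 + a • x k p ^ (p - 1)) • partialD k p))
    (hb : w ∈ orbit ((1 + b • x k p ^ (p - 1)) • partialD k p)) : a = b := by
  obtain ⟨g, hg, h1⟩ := (mem_orbit_iff_of_degree_neg_one hp a w).1 ha
  obtain ⟨g', hg', h2⟩ := (mem_orbit_iff_of_degree_neg_one hp b w).1 hb
  obtain rfl : g = g' := by linear_combination g' * hg - g * hg'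
  rw [h1] at h2
  have hu : coeffA 0 g ≠ 0 := (isUnit_iff_coeffA g).1 (IsUnit.of_mul_eq_one_right _ hg)
  exact neg_inj.1 (mul_right_cancel₀ (pow_ne_zero p hu) h2)

theorem eq_of_mem_orbit_degree_small [IsAlgClosed k] (hp : 3 < p) {n : ℕ} (hn : 2 ≤ n)
    (hnp : 2 * n ≤ p) {a b : k} {w : W k p}
    (ha : w ∈ orbit ((x k p ^ n + a • x k p ^ (2 * n - 1)) • partialD k p))
    (hb : w ∈ orbit ((x k p ^ n + b • x k p ^ (2 * n - 1)) • partialD k p)) : a = b := by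
  obtain ⟨h, g, hw, hg, h1⟩ := (mem_orbit_iff_of_degree_small hp hn hnp a w).1 ha
  obtain ⟨h', g', hw', hg', h2⟩ := (mem_orbit_iff_of_degree_small hp hn hnp b w).1 hb
  rw [hw] at hw'
  -- The cofactor `h` is unique only up to multiples of `x^(p-n)`, so the inverses are compared
  -- after multiplication by `x^n`; coefficient `n - 1` survives since `2n - 1 < p`.
  have h3 : x k p ^ n * g = x k p ^ n * g' := by
    linear_combination (-g * g') * hw' + x k p ^ n * g' * hg - x k p ^ n * g * hg'
  have h4 := congrArg (coeffA (2 * n - 1)) h3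
  rw [coeffA_x_pow_mul (by omega), coeffA_x_pow_mul (by omega), if_pos (by omega),
    if_pos (by omega), show 2 * n - 1 - n = n - 1 by omega, h1, h2] at h4
  exact neg_inj.1 h4

theorem exists_mem_orbit_degree_neg_one (hp : 3 < p) {w : W k p}
    (h : coeffA 0 (w (x k p)) ≠ 0) :
    ∃ a : k, w ∈ orbit ((1 + a • x k p ^ (p - 1)) • partialD k p) := by
  obtain ⟨g, hg⟩ := ((isUnit_iff_coeffA _).2 h).exists_right_inv
  have hu : coeffA 0 g ≠ 0 := (isUnit_iff_coeffA g).1 (IsUnit.of_mul_eq_one_right _ hg)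
  refine ⟨-(coeffA (p - 1) g / coeffA 0 g ^ p),
    (mem_orbit_iff_of_degree_neg_one hp _ w).2 ⟨g, hg, ?_⟩⟩
  rw [neg_neg, div_mul_cancel₀ _ (pow_ne_zero p hu)]

theorem zariskiDim_orbit_degree_neg_one [Infinite k] (hp : 3 < p) (a : k) :
    zariskiDim k (orbit ((1 + a • x k p ^ (p - 1)) • partialD k p)) =
      ((p - 1 : ℕ) : WithBot ℕ∞) := by
  -- `N = p` selects the coefficient of `x^(p-1)` in `1/f`, and `E = p` accounts for its scaling by
  -- `u(0)^p`.
  have h := zariskiDim_residue (k := k) (p := p) (n := 0) (N := p) (E := p) (by omega) (by omega) a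
  rw [Nat.sub_zero] at h
  rw [← h]
  congr 1
  ext w
  rw [mem_orbit_iff_of_degree_neg_one hp]
  simp only [pow_zero, one_mul, Set.mem_ofPred_eq]
  exact ⟨fun ⟨g, h1, h2⟩ => ⟨_, g, rfl, h1, h2⟩, fun ⟨_, g, h1, h2, h3⟩ => ⟨g, h1 ▸ h2, h3⟩⟩

theorem zariskiDim_orbit_degree_small [IsAlgClosed k] (hp : 3 < p) {n : ℕ} (hn : 2 ≤ n)
    (hnp : 2 * n ≤ p) (a : k) :
    zariskiDim k (orbit ((x k p ^ n + a • x k p ^ (2 * n - 1)) • partialD k p)) =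
      ((p - n - 1 : ℕ) : WithBot ℕ∞) := by
  have : Infinite k := IsAlgClosed.instInfinite
  -- `N = n` selects the residue, and `E = 0` since it is invariant without any scaling.
  rw [← zariskiDim_residue (k := k) (p := p) (n := n) (N := n) (E := 0) hn (by omega) a]
  congr 1
  ext w
  rw [mem_orbit_iff_of_degree_small hp hn hnp]
  simp only [pow_zero, mul_one, Set.mem_ofPred_eq]

theorem zariskiDim_orbit_degree_large [IsAlgClosed k] (hp : 3 < p) {n : ℕ} (hn : p < 2 * n)
    (hnp : n < p) :
    zariskiDim k (orbit (x k p ^ n • partialD k p)) = ((p - n : ℕ) : WithBot ℕ∞) := by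
  have : Infinite k := IsAlgClosed.instInfinite
  rw [← zariskiDim_order (k := k) hnp]
  congr 1
  ext w
  exact mem_orbit_iff_of_degree_large hp hn hnp w

theorem zariskiDim_orbit_degree_zero [Infinite k] (hp : 3 < p) {a : k} (ha : a ≠ 0) :
    zariskiDim k (orbit ((a • x k p) • partialD k p)) = ((p - 2 : ℕ) : WithBot ℕ∞) := by
  rw [← zariskiDim_leading_term (by omega) a]
  congr 1
  ext w
  exact mem_orbit_iff_of_degree_zero hp ha w

omit [Fact p.Prime] in
theorem order_binomial {n m : ℕ} (hn : n < p) (hnm : n < m) (a : k) :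
    x k p ^ n ∣ ((x k p ^ n + a • x k p ^ m) • partialD k p) (x k p) ∧
      coeffA n (((x k p ^ n + a • x k p ^ m) • partialD k p) (x k p)) ≠ 0 := by
  rw [smul_partialD_x]
  refine ⟨dvd_add (dvd_refl _) (x_pow_dvd_smul (pow_dvd_pow _ hnm.le) a), ?_⟩
  rw [map_add, map_smul, coeffA_x_pow hn, if_pos rfl, coeffA_x_pow hn, if_neg hnm.ne, smul_zero,
    add_zero]
  exact one_ne_zero

end

end WittAlgebra

end

open WittAlgebra in
theorem theorem1 (k : Type*) [Field k] [IsAlgClosed k] (p : ℕ) [CharP k p] (hp : 3 < p) :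
    -- every nonzero element has a unique degree, which lies in `{-1, …, p - 2}` and is preserved
    -- by all automorphisms, so that orbits have degrees
    (∀ w : WittAlgebra.W k p, w ≠ 0 → ∃! i : ℤ, WittAlgebra.HasDegree w i) ∧
    (∀ (w : WittAlgebra.W k p) (i : ℤ), WittAlgebra.HasDegree w i → -1 ≤ i ∧ i ≤ (p : ℤ) - 2) ∧
    (∀ (σ : WittAlgebra.W k p ≃ₗ⁅k⁆ WittAlgebra.W k p) (w : WittAlgebra.W k p) (i : ℤ),
      WittAlgebra.HasDegree w i → WittAlgebra.HasDegree (σ w) i) ∧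
    -- representatives of the orbits of each degree
    WittAlgebra.IsSetOfRepresentatives
      {w : WittAlgebra.W k p | ∃ a : k, w = WittAlgebra.e k p (-1) + a • WittAlgebra.e k p ((p : ℤ) - 2)} (-1) ∧
    WittAlgebra.IsSetOfRepresentatives
      {w : WittAlgebra.W k p | ∃ a : k, a ≠ 0 ∧ w = a • WittAlgebra.e k p 0} 0 ∧
    (∀ i : ℕ, 1 ≤ i → i < (p - 1) / 2 →
      WittAlgebra.IsSetOfRepresentatives
        {w : WittAlgebra.W k p | ∃ a : k, w = WittAlgebra.e k p i + a • WittAlgebra.e k p (2 * i)} i) ∧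
    (∀ i : ℕ, (p - 1) / 2 ≤ i → i ≤ p - 2 →
      WittAlgebra.IsSetOfRepresentatives {WittAlgebra.e k p i} i) ∧
    -- different parameters give different orbits
    (∀ a b : k, WittAlgebra.orbit (WittAlgebra.e k p (-1) + a • WittAlgebra.e k p ((p : ℤ) - 2)) =
      WittAlgebra.orbit (WittAlgebra.e k p (-1) + b • WittAlgebra.e k p ((p : ℤ) - 2)) → a = b) ∧
    (∀ a b : k, a ≠ 0 → b ≠ 0 →
      WittAlgebra.orbit (a • WittAlgebra.e k p 0) = WittAlgebra.orbit (b • WittAlgebra.e k p 0) → a = b) ∧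
    (∀ i : ℕ, 1 ≤ i → i < (p - 1) / 2 → ∀ a b : k,
      WittAlgebra.orbit (WittAlgebra.e k p i + a • WittAlgebra.e k p (2 * i)) =
        WittAlgebra.orbit (WittAlgebra.e k p i + b • WittAlgebra.e k p (2 * i)) → a = b) ∧
    -- dimensions of the orbits
    (∀ a : k, WittAlgebra.zariskiDim k
      (WittAlgebra.orbit (WittAlgebra.e k p (-1) + a • WittAlgebra.e k p ((p : ℤ) - 2))) = ((p - 1 : ℕ) : WithBot ℕ∞)) ∧
    (∀ a : k, a ≠ 0 →
      WittAlgebra.zariskiDim k (WittAlgebra.orbit (a • WittAlgebra.e k p 0)) = ((p - 2 : ℕ) : WithBot ℕ∞)) ∧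
    (∀ i : ℕ, 1 ≤ i → i < (p - 1) / 2 → ∀ a : k,
      WittAlgebra.zariskiDim k (WittAlgebra.orbit (WittAlgebra.e k p i + a • WittAlgebra.e k p (2 * i))) =
        ((p - i - 2 : ℕ) : WithBot ℕ∞)) ∧
    (∀ i : ℕ, (p - 1) / 2 ≤ i → i ≤ p - 2 →
      WittAlgebra.zariskiDim k (WittAlgebra.orbit (WittAlgebra.e k p i)) = ((p - i - 1 : ℕ) : WithBot ℕ∞)) := by
  have hprime : p.Prime := (CharP.char_is_prime_or_zero k p).resolve_right (by omega)
  have : Fact p.Prime := ⟨hprime⟩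
  have : Infinite k := IsAlgClosed.instInfinite
  -- As `p` is odd, for `n = i + 1` the condition `i < (p - 1) / 2` means `2n ≤ p`, and its negation
  -- means `p < 2n`.
  have hodd : p % 2 = 1 := hprime.mod_two_eq_one_iff_ne_two.2 (by omega)
  have e1 (a : k) : e k p (-1) + a • e k p ((p : ℤ) - 2) =
      (1 + a • x k p ^ (p - 1)) • partialD k p := by
    rw [e_add_smul_e 0 (p - 1) (by norm_num) (by omega), pow_zero]
  have e2 (a : k) : a • e k p 0 = (a • x k p) • partialD k p := by
    rw [e_eq 1 (by norm_num), pow_one, smul_assoc]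
  have e3 (i : ℕ) (a : k) : e k p i + a • e k p (2 * i) =
      (x k p ^ (i + 1) + a • x k p ^ (2 * (i + 1) - 1)) • partialD k p :=
    e_add_smul_e (i + 1) (2 * (i + 1) - 1) (by push_cast; ring) (by omega) a
  have e4 (i : ℕ) : e k p i = x k p ^ (i + 1) • partialD k p := e_eq (i + 1) (by push_cast; ring)
  refine ⟨fun w hw => existsUnique_hasDegree hw, fun w i h => ?_, fun σ w i h => h.map hp σ,
    ?_, ?_, fun i h1 h2 => ?_, fun i h1 h2 => ?_, fun a b h => ?_, fun a b ha hb h => ?_,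
    fun i h1 h2 a b h => ?_, fun a => ?_, fun a ha => ?_, fun i h1 h2 a => ?_, fun i h1 h2 => ?_⟩
  · obtain ⟨n, hn, rfl⟩ := h.exists_eq
    omega
  · refine isSetOfRepresentatives_of_family (P := fun _ => True)
      (r := fun a : k => (1 + a • x k p ^ (p - 1)) • partialD k p) (n := 0) (by omega)
      (by norm_num) (fun w => by simp [e1]) (fun a _ => ?_) (fun w _ h => ?_)
      (fun a b w _ _ ha hb => eq_of_mem_orbit_degree_neg_one hp ha hb)
    · simpa using order_binomial (p := p) (n := 0) (m := p - 1) (by omega) (by omega) a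
    · obtain ⟨a, ha⟩ := exists_mem_orbit_degree_neg_one hp h
      exact ⟨a, trivial, ha⟩
  · refine isSetOfRepresentatives_of_family (P := fun a => a ≠ 0)
      (r := fun a : k => (a • x k p) • partialD k p) (n := 1) (by omega) (by norm_num)
      (fun w => by simp [e2]) (fun a ha => ?_) (fun w h h' => ?_)
      (fun a b w ha hb hwa hwb => ?_)
    · have := (mem_orbit_iff_of_degree_zero hp ha _).1 (mem_orbit_self _)
      refine ⟨(x_pow_dvd_iff (by omega) _).2 fun n hn => ?_, by rw [this.2]; exact ha⟩
      rw [Nat.lt_one_iff.1 hn, this.1]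
    · exact ⟨_, h', (mem_orbit_iff_of_degree_zero hp h' w).2
        ⟨(x_pow_dvd_iff (by omega) _).1 h 0 one_pos, rfl⟩⟩
    · rw [← ((mem_orbit_iff_of_degree_zero hp ha w).1 hwa).2,
        ← ((mem_orbit_iff_of_degree_zero hp hb w).1 hwb).2]
  · refine isSetOfRepresentatives_of_family (P := fun _ => True)
      (r := fun a : k => (x k p ^ (i + 1) + a • x k p ^ (2 * (i + 1) - 1)) • partialD k p)
      (n := i + 1) (by omega) (by push_cast; ring) (fun w => by simp [e3])
      (fun a _ => order_binomial (by omega) (by omega) a) (fun w h h' => ?_)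
      (fun a b w _ _ ha hb => eq_of_mem_orbit_degree_small hp (by omega) (by omega) ha hb)
    obtain ⟨a, ha⟩ := exists_mem_orbit_monic_binomial (by omega) (by omega) h h'
    exact ⟨a, trivial, ha⟩
  · refine isSetOfRepresentatives_of_family (α := Unit) (P := fun _ => True)
      (r := fun _ => x k p ^ (i + 1) • partialD k p)
      (n := i + 1) (by omega) (by push_cast; ring) (fun w => by simp [e4])
      (fun _ _ => (mem_orbit_iff_of_degree_large hp (by omega) (by omega) _).1 (mem_orbit_self _))
      (fun w h h' => ⟨(), trivial,
        (mem_orbit_iff_of_degree_large hp (by omega) (by omega) w).2 ⟨h, h'⟩⟩)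
      (fun _ _ _ _ _ _ _ => rfl)
  · rw [e1, e1] at h
    exact eq_of_mem_orbit_degree_neg_one hp (mem_orbit_self _) (h ▸ mem_orbit_self _)
  · rw [e2, e2] at h
    have h1 := (mem_orbit_iff_of_degree_zero hp ha _).1 (mem_orbit_self _)
    have h2 := (mem_orbit_iff_of_degree_zero hp hb _).1 (h ▸ mem_orbit_self _)
    rw [← h1.2, ← h2.2]
  · rw [e3, e3] at h
    exact eq_of_mem_orbit_degree_small hp (by omega) (by omega) (mem_orbit_self _)
      (h ▸ mem_orbit_self _)
  · rw [e1, zariskiDim_orbit_degree_neg_one hp]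
  · rw [e2, zariskiDim_orbit_degree_zero hp ha]
  · rw [e3, zariskiDim_orbit_degree_small hp (by omega) (by omega), show p - (i + 1) - 1 = p - i - 2 by omega]
  · rw [e4, zariskiDim_orbit_degree_large hp (by omega) (by omega), show p - (i + 1) = p - i - 1 by omega]
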